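/- Let $p\ge 1$, $j\in\{1,\dots,p\}$, and let $P_0$ be the law of a pair $(X,y)$ with $X\sim\mathcal N(\mu,\Sigma)$ in $\mathbb R^p$, $\Sigma$ positive definite, and $y=X\beta+\epsilon$, where $\beta\in\mathbb R^p$ and $\epsilon\sim\mathcal N(0,\sigma^2)$ is independent of $X$. Write $x^{-j}$ for the vector $x$ without its $j$-th coordinate $x^j$, and assume the conditional null hypothesis $X^j\perp\!\!\!\perp y\mid X^{-j}$. Consider three samples of i.i.d. observations from $P_0$, independent of each other: a test sample $(x_i,y_i)_{i\le n_{\mathrm{test}}}$, $n_{\mathrm{test}}\ge 1$, and two training samples of size $n_{\mathrm{train}}$ each. Let $\widehat\beta$ be the ordinary least squares estimate of $\beta$ from the regression of $y$ on $X$ (without intercept) over the first training sample, and $\widehat m(x)=x\widehat\beta$. Let $\widehat\nu_{-j}$ be the ordinary least squares regression of $X^j$ on $X^{-j}$ over the second training sample, with an intercept or, if $\mu=0$, alternatively without one. Let $\pi$ be a (deterministic or random) permutation of $\{1,\dots,n_{\mathrm{test}}\}$ independent of the data, let $\widetilde x'_i$ be the vector with $(\widetilde x'_i)^{l}=x_i^{l}$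 for $l\ne j$ and $$(\widetilde x'_i)^{j}=\widehat\nu_{-j}(x_i^{-j})+x_{\pi(i)}^j-\widehat\nu_{-j}(x_{\pi(i)}^{-j}),$$ and let $$\widehat\psi_{\mathrm{CPI}}(j)=\frac1{n_{\mathrm{test}}}\sum_{i=1}^{n_{\mathrm{test}}}\Big[\big(\widehat m(\widetilde x'_i)-y_i\big)^2-\big(\widehat m(x_i)-y_i\big)^2\Big].$$ Then, for all sufficiently large $n_{\mathrm{train}}$, $\widehat\psi_{\mathrm{CPI}}(j)$ is integrable, and $$\mathbb E\big[\widehat\psi_{\mathrm{CPI}}(j)\big]=O\big(1/n_{\mathrm{train}}^2\big)\qquad(n_{\mathrm{train}}\to\infty),$$ where the bound and the threshold on $n_{\mathrm{train}}$ are uniform in $n_{\mathrm{test}}$ and in $\pi$. -/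

import Mathlib

open MeasureTheory ProbabilityTheory
open scoped NNReal Matrix

noncomputable section

namespace CPI

/-- An observation `(x, y)`: a covariate vector in `ℝ^p` and a real response. -/
abbrev Obs (p : ℕ) : Type := EuclideanSpace ℝ (Fin p) × ℝ

/-- The covariate vector `x^{-j}`: the vector `x` with the `j`-th coordinate excluded. -/
def drop {p : ℕ} (j : Fin p) (x : EuclideanSpace ℝ (Fin p)) : {l : Fin p // l ≠ j} → ℝ :=
  fun l => x l

theorem measurable_drop {p : ℕ} (j : Fin p) : Measurable (drop j) := by
  unfold drop
  fun_prop

/-- The conditional null hypothesis under the law `P₀` of `(X, y)`: `X^j` and `y` are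
conditionally independent given `X^{-j}`. -/
def ConditionalNull {p : ℕ} (P₀ : Measure (Obs p)) [IsFiniteMeasure P₀] (j : Fin p) : Prop :=
  CondIndepFun (MeasurableSpace.comap (fun z : Obs p => drop j z.1) inferInstance)
    ((measurable_drop j).comp measurable_fst).comap_le
    (fun z : Obs p => z.1 j) (fun z : Obs p => z.2) P₀

/-- The Gaussian linear model: under the law `P₀` of `(X, y)`, the noise `ε = y - Xβ` is
`N(0, σ²)`-distributed and independent of `X`. -/
def LinearModel {p : ℕ} (P₀ : Measure (Obs p)) (β : Fin p → ℝ) (σ : ℝ≥0) : Prop :=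
  P₀.map (fun z : Obs p => z.2 - ∑ l, z.1 l * β l) = gaussianReal 0 (σ ^ 2) ∧
  IndepFun (fun z : Obs p => z.2 - ∑ l, z.1 l * β l) (fun z : Obs p => z.1) P₀

/-- The ordinary least squares coefficients `(AᵀA)⁻¹ Aᵀ b` of the response vector `b` on the
design matrix `A` (one row per observation, one column per regressor). -/
def ols {n : ℕ} {ι : Type*} [Fintype ι] [DecidableEq ι]
    (A : Matrix (Fin n) ι ℝ) (b : Fin n → ℝ) : ι → ℝ :=
  (Aᵀ * A)⁻¹ *ᵥ (Aᵀ *ᵥ b)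

/-- `β̂`: least squares regression of `y` on `X` over the training sample `D`. -/
def betaHat {p n : ℕ} (D : Fin n → Obs p) : Fin p → ℝ :=
  ols (Matrix.of fun i l => (D i).1 l) (fun i => (D i).2)

/-- The fitted linear model `m̂(x) = xβ̂`. -/
def mHat {p n : ℕ} (D : Fin n → Obs p) (x : EuclideanSpace ℝ (Fin p)) : ℝ :=
  ∑ l, x l * betaHat D l

/-- `ν̂_{-j}` without intercept: the least squares linear prediction of `X^j` from `X^{-j}`. -/
def nuHatLinear {p : ℕ} (j : Fin p) (n : ℕ) (D : Fin n → Obs p)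
    (z : {l : Fin p // l ≠ j} → ℝ) : ℝ :=
  let γ : {l : Fin p // l ≠ j} → ℝ :=
    ols (Matrix.of fun i l => drop j (D i).1 l) (fun i => (D i).1 j)
  ∑ l, z l * γ l

/-- `ν̂_{-j}` with intercept: the least squares affine prediction of `X^j` from `X^{-j}`. The
regressor with index `none` is the constant `1`. -/
def nuHatAffine {p : ℕ} (j : Fin p) (n : ℕ) (D : Fin n → Obs p)
    (z : {l : Fin p // l ≠ j} → ℝ) : ℝ :=
  let γ : Option {l : Fin p // l ≠ j} → ℝ :=
    ols (Matrix.of fun i o => o.elim 1 (drop j (D i).1)) (fun i => (D i).1 j)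
  γ none + ∑ l, z l * γ (some l)

/-- The conditionally permuted observation `x̃'_{i,k}`: all coordinates are those of `x_i`, except
the `j`-th one, which is `ν̂(x_i^{-j}) + (x_k^j - ν̂(x_k^{-j}))`. -/
def condSample {p : ℕ} (j : Fin p) (ν : ({l : Fin p // l ≠ j} → ℝ) → ℝ)
    (xi xk : EuclideanSpace ℝ (Fin p)) : EuclideanSpace ℝ (Fin p) :=
  WithLp.toLp 2 fun l => if l = j then ν (drop j xi) + (xk j - ν (drop j xk)) else xi l

/-- The quadratic loss. -/
def quadLoss (a b : ℝ) : ℝ := (a - b) ^ 2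

/-- The CPI estimate of the importance of the `j`-th covariate on the test sample `T`, with loss
`ℓ`, regressor `m`, conditional mean regressor `ν` and residuals permuted across the individuals
by `π`. -/
def cpi {p nt : ℕ} (ℓ : ℝ → ℝ → ℝ) (j : Fin p) (m : EuclideanSpace ℝ (Fin p) → ℝ)
    (ν : ({l : Fin p // l ≠ j} → ℝ) → ℝ) (π : Equiv.Perm (Fin nt)) (T : Fin nt → Obs p) : ℝ :=
  (1 / (nt : ℝ)) * ∑ i, (ℓ (m (condSample j ν (T i).1 (T (π i)).1)) (T i).2
    - ℓ (m (T i).1) (T i).2)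

/-- The three disjoint samples: the test sample, the training sample of `m̂` (that is, of `β̂`) and
the training sample of `ν̂_{-j}`. -/
inductive Fold where
  | test
  | trainM
  | trainNu

end CPI

end

/-! Let `ρ` be the residual of `X^j` regressed on `X^{-j}` under the true law, `v` its variance, `e
= β̂ - β`, and `u` the error of the fitted slopes of `ν̂`. The null hypothesis forces `β j = 0`
(`coeff_eq_zero_of_conditionalNull`): `ρ` is centered and independent of `X^{-j}`, hence
uncorrelated with `y`, whereas the linear model gives `E[ρ y] = v β_j`.

Permuting residuals moves the `j`-th coordinate by `δ = Δρ - u·Δx`, the fitted intercept cancelling.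
As `β j = 0`, the loss increment is `e_j δ (e_j δ + 2 (x·e - ε))`. Take its mean when `π i ≠ i`
(`hasMean_loss_increment`). Since `E[Δρ²] = 2v` and `2 E[Δρ x_j] = -2v`, the terms of order
`E[e_j²]` cancel exactly. Terms linear in `u` vanish because `u` is unbiased and independent of the
rest, and `Δρ` is uncorrelated with `ε`. What remains is `E[e_j²] E[(u·Δx)²]`, a product of two mean
square errors of order `1/n`.

For that rate, the least squares error given the design has mean zero and variance proportional to a
diagonal entry of the inverse Gram matrix (`ols_unbiased`), which is bounded by the inverse residual
sum of squares of one column on the others. Given the others, that column is a shift plus i.i.d.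
Gaussian noise, so the residual sum of squares dominates a scaled noncentral chi-square variable
with `3m` degrees of freedom, `m` of order `n` (`lintegral_inv_residualSS_design_le`). Its inverse
moment is bounded by hand: within a triple, `1/(x₁² + x₂² + x₃²) ≤ ∏ |x_s|^{-2/3}`, whose factors
have Gaussian means bounded uniformly in the shift; across triples, the inequality of harmonic and
arithmetic means yields the factor `1/m`. -/

namespace CPI

open scoped ENNReal

/-! ### Inverse moments of noncentral chi-square variables -/

/-- The singularity `|x|^{-2/3}` is integrable on the unit interval. -/
theorem lintegral_ball_enorm_rpow_neg_lt_top :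
    ∫⁻ x in Metric.ball (0 : ℝ) 1, ‖x‖ₑ ^ (-(2 / 3) : ℝ) < ∞ := by
  have h : IntegrableOn (fun x : ℝ => |x| ^ (-(2 / 3) : ℝ)) (Metric.ball 0 1) := by
    refine integrableOn_ball_of_norm_le_rpow (C := 1) (α := 2 / 3) (by simp) (by norm_num) ?_ ?_
    · refine Filter.Eventually.of_forall fun x => ?_
      simp [abs_of_nonneg (Real.rpow_nonneg (abs_nonneg x) _)]
    · exact (by fun_prop : Measurable fun x : ℝ => |x| ^ (-(2 / 3) : ℝ)).aestronglyMeasurable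
  refine lt_of_eq_of_lt (lintegral_congr_ae ?_) h.2
  filter_upwards [ae_restrict_of_ae (measure_eq_zero_iff_ae_notMem.1 (measure_singleton (0 : ℝ)))]
    with x hx
  have hx0 : 0 < |x| := abs_pos.2 (by simpa using hx)
  rw [Real.enorm_eq_ofReal_abs x, ENNReal.ofReal_rpow_of_pos hx0, Real.enorm_eq_ofReal
    (Real.rpow_nonneg hx0.le _)]

/-- The `-2/3` absolute moments of the real Gaussian laws with a given variance are bounded. -/
theorem exists_lintegral_gaussianReal_rpow_le {v : ℝ≥0} (hv : v ≠ 0) :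
    ∃ K : ℝ≥0∞, K ≠ ∞ ∧ ∀ a : ℝ,
      ∫⁻ x, ‖x + a‖ₑ ^ (-(2 / 3) : ℝ) ∂(gaussianReal 0 v) ≤ K := by
  set c : ℝ≥0∞ := ENNReal.ofReal (√(2 * Real.pi * v))⁻¹ with hc
  -- Outside the unit ball the integrand is at most `1`; inside, the Gaussian density is at most its
  -- peak `c`, which does not depend on the mean. Hence uniformity in `a`.
  refine ⟨1 + c * ∫⁻ x in Metric.ball (0 : ℝ) 1, ‖x‖ₑ ^ (-(2 / 3) : ℝ), ?_, fun a => ?_⟩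
  · exact ENNReal.add_ne_top.2 ⟨by simp, ENNReal.mul_ne_top ENNReal.ofReal_ne_top
      lintegral_ball_enorm_rpow_neg_lt_top.ne⟩
  have hm : Measurable fun x : ℝ => ‖x‖ₑ ^ (-(2 / 3) : ℝ) := by fun_prop
  have h1 : ∫⁻ x, ‖x + a‖ₑ ^ (-(2 / 3) : ℝ) ∂(gaussianReal 0 v)
      = ∫⁻ x, ‖x‖ₑ ^ (-(2 / 3) : ℝ) ∂(gaussianReal a v) := by
    have := gaussianReal_map_add_const (μ := 0) (v := v) a
    rw [zero_add] at this
    rw [← this, lintegral_map hm (by fun_prop)]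
  have h2 : gaussianReal a v ≤ c • (volume : Measure ℝ) := by
    rw [gaussianReal_of_var_ne_zero a hv, ← withDensity_const]
    refine withDensity_mono (Filter.Eventually.of_forall fun x => ?_)
    refine ENNReal.ofReal_le_ofReal ?_
    rw [gaussianPDFReal]
    refine mul_le_of_le_one_right (by positivity) (Real.exp_le_one_iff.2 ?_)
    rw [neg_div]
    exact neg_nonpos.2 (by positivity)
  rw [h1, ← lintegral_add_compl _ (measurableSet_ball (x := (0 : ℝ)) (ε := 1)),
    add_comm]
  refine add_le_add ?_ ?_
  · calc ∫⁻ x in (Metric.ball (0 : ℝ) 1)ᶜ, ‖x‖ₑ ^ (-(2 / 3) : ℝ) ∂(gaussianReal a v)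
        ≤ ∫⁻ x in (Metric.ball (0 : ℝ) 1)ᶜ, 1 ∂(gaussianReal a v) := by
          refine setLIntegral_mono measurable_const fun x hx => ?_
          have hx1 : (1 : ℝ≥0∞) ≤ ‖x‖ₑ := by
            rw [Real.enorm_eq_ofReal_abs]
            exact ENNReal.one_le_ofReal.2 (by simpa using hx)
          rw [ENNReal.rpow_neg]
          exact ENNReal.inv_le_one.2 (ENNReal.one_le_rpow hx1 (by norm_num))
      _ ≤ 1 := by
          simpa using prob_le_one
  · calc ∫⁻ x in Metric.ball (0 : ℝ) 1, ‖x‖ₑ ^ (-(2 / 3) : ℝ) ∂(gaussianReal a v)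
        ≤ ∫⁻ x in Metric.ball (0 : ℝ) 1, ‖x‖ₑ ^ (-(2 / 3) : ℝ) ∂(c • volume) :=
          lintegral_mono' (Measure.restrict_mono le_rfl h2) le_rfl
      _ = _ := by rw [Measure.restrict_smul, lintegral_smul_measure, smul_eq_mul]

/-- The harmonic mean is at most the arithmetic mean, for extended nonnegative reals. -/
theorem inv_sum_le_sum_inv {ι : Type*} [Fintype ι] [Nonempty ι] (s : ι → ℝ≥0∞)
    (hs : ∀ t, s t ≠ ∞) :
    (∑ t, s t)⁻¹ ≤ ((Fintype.card ι : ℝ≥0∞) ^ 2)⁻¹ * ∑ t, (s t)⁻¹ := by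
  by_cases h0 : ∃ t, s t = 0
  · obtain ⟨t, ht⟩ := h0
    have : ∑ t, (s t)⁻¹ = ∞ := ENNReal.sum_eq_top.2 ⟨t, Finset.mem_univ _, by simp [ht]⟩
    rw [this, ENNReal.mul_top (ENNReal.inv_ne_zero.2 (by finiteness))]
    exact le_top
  push Not at h0
  set r : ι → ℝ := fun t => (s t).toReal with hr
  have hpos : ∀ t, 0 < r t := fun t => ENNReal.toReal_pos (h0 t) (hs t)
  have hsr : ∀ t, s t = ENNReal.ofReal (r t) := fun t => (ENNReal.ofReal_toReal (hs t)).symm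
  have hsum : 0 < ∑ t, r t := Finset.sum_pos (fun t _ => hpos t) Finset.univ_nonempty
  have hcard : (0 : ℝ) < Fintype.card ι := by exact_mod_cast Fintype.card_pos
  have key : (∑ t, r t)⁻¹ ≤ ((Fintype.card ι : ℝ) ^ 2)⁻¹ * ∑ t, (r t)⁻¹ := by
    -- Cauchy–Schwarz in Engel form with all numerators equal to `1`.
    have := Finset.sq_sum_div_le_sum_sq_div Finset.univ (fun _ : ι => (1 : ℝ))
      (fun t _ => hpos t)
    simp only [Finset.sum_const, Finset.card_univ, nsmul_eq_mul, mul_one, one_pow, one_div] at this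
    rw [inv_mul_eq_div, le_div_iff₀ (by positivity), mul_comm, ← div_eq_mul_inv]
    exact this
  simp_rw [hsr]
  rw [← ENNReal.ofReal_sum_of_nonneg fun t _ => (hpos t).le, ← ENNReal.ofReal_inv_of_pos hsum]
  simp_rw [fun t => (ENNReal.ofReal_inv_of_pos (hpos t)).symm]
  rw [← ENNReal.ofReal_sum_of_nonneg fun t _ => (inv_pos.2 (hpos t)).le]
  refine (ENNReal.ofReal_le_ofReal key).trans_eq ?_
  rw [ENNReal.ofReal_mul (by positivity), ENNReal.ofReal_inv_of_pos (by positivity),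
    ENNReal.ofReal_pow hcard.le, ENNReal.ofReal_natCast]

/-- Each `x s ^ (2/3)` is at most the cube root of the sum of squares; multiply the three bounds.
This splits the singularity `1/|x|²` of `ℝ³` into one-dimensional factors of exponent `2/3 < 1`,
hence integrable. Finiteness excludes `0 * ∞` when the product is inverted. -/
theorem inv_sum_sq_le_prod_rpow (x : Fin 3 → ℝ≥0∞) (hx : ∀ s, x s ≠ ∞) :
    (∑ s, x s ^ 2)⁻¹ ≤ ∏ s, x s ^ (-(2 / 3) : ℝ) := by
  have h1 : ∀ s, x s ^ (2 / 3 : ℝ) ≤ (∑ s, x s ^ 2) ^ (1 / 3 : ℝ) := fun s => by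
    have : x s ^ (2 / 3 : ℝ) = (x s ^ 2) ^ (1 / 3 : ℝ) := by
      rw [← ENNReal.rpow_natCast, ← ENNReal.rpow_mul]
      norm_num
    rw [this]
    exact ENNReal.rpow_le_rpow
      (Finset.single_le_sum (f := fun s => x s ^ 2) (fun _ _ => zero_le) (Finset.mem_univ s))
      (by norm_num)
  have h2 : ∏ s, x s ^ (2 / 3 : ℝ) ≤ ∑ s, x s ^ 2 := by
    refine (Finset.prod_le_prod' fun s _ => h1 s).trans_eq ?_
    rw [Finset.prod_const, Finset.card_univ, Fintype.card_fin, ← ENNReal.rpow_natCast,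
      ← ENNReal.rpow_mul]
    norm_num
  have h3 : ∀ s, x s ^ (2 / 3 : ℝ) ≠ ∞ := fun s =>
    ENNReal.rpow_ne_top_of_nonneg (by norm_num) (hx s)
  refine (ENNReal.inv_le_inv.2 h2).trans_eq ?_
  simp_rw [ENNReal.rpow_neg]
  rw [Fin.prod_univ_three, Fin.prod_univ_three, ENNReal.mul_inv, ENNReal.mul_inv]
  · exact Or.inr (h3 1)
  · exact Or.inl (h3 0)
  · exact Or.inr (h3 2)
  · exact Or.inl (ENNReal.mul_ne_top (h3 0) (h3 1))

/-- The inverse of a noncentral chi-square variable with `3m` degrees of freedom has a mean of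
order `1/m`, uniformly in the noncentrality. -/
theorem lintegral_inv_sum_sq_gaussian_le {Ω : Type*} [MeasurableSpace Ω] {P : Measure Ω}
    {v : ℝ≥0} {K : ℝ≥0∞}
    (hK : ∀ a : ℝ, ∫⁻ x, ‖x + a‖ₑ ^ (-(2 / 3) : ℝ) ∂(gaussianReal 0 v) ≤ K)
    {m : ℕ} (hm : 0 < m) (G : Fin m × Fin 3 → Ω → ℝ) (hG : ∀ b, Measurable (G b))
    (hlaw : ∀ b, P.map (G b) = gaussianReal 0 v) (hind : iIndepFun G P)
    (a : Fin m × Fin 3 → ℝ) :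
    ∫⁻ ω, (∑ b, ‖G b ω + a b‖ₑ ^ 2)⁻¹ ∂P ≤ K ^ 3 / m := by
  have : Nonempty (Fin m) := ⟨⟨0, hm⟩⟩
  have hm0 : (m : ℝ≥0∞) ≠ 0 := by exact_mod_cast hm.ne'
  calc ∫⁻ ω, (∑ b, ‖G b ω + a b‖ₑ ^ 2)⁻¹ ∂P
      ≤ ∫⁻ ω, ((m : ℝ≥0∞) ^ 2)⁻¹ * ∑ t, ∏ s, ‖G (t, s) ω + a (t, s)‖ₑ ^ (-(2 / 3) : ℝ) ∂P := by
        refine lintegral_mono fun ω => ?_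
        rw [Fintype.sum_prod_type]
        have := inv_sum_le_sum_inv (fun t : Fin m => ∑ s, ‖G (t, s) ω + a (t, s)‖ₑ ^ 2)
          (fun t => ENNReal.sum_ne_top.2 fun s _ => by finiteness)
        rw [Fintype.card_fin] at this
        refine this.trans ?_
        gcongr with t
        exact inv_sum_sq_le_prod_rpow _ fun s => by finiteness
    _ = ((m : ℝ≥0∞) ^ 2)⁻¹ *
          ∑ t, ∏ s, ∫⁻ ω, ‖G (t, s) ω + a (t, s)‖ₑ ^ (-(2 / 3) : ℝ) ∂P := by
        rw [lintegral_const_mul _ (by fun_prop), lintegral_finsetSum _ (by fun_prop)]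
        congr 1
        refine Finset.sum_congr rfl fun t _ => ?_
        -- Independence is used only within a triple; across triples linearity suffices.
        refine lintegral_prod_eq_prod_lintegral_of_indepFun Finset.univ
          (fun s ω => ‖G (t, s) ω + a (t, s)‖ₑ ^ (-(2 / 3) : ℝ)) ?_ (by fun_prop)
        have h1 : iIndepFun (fun s => G (t, s)) P :=
          hind.precomp (g := fun s : Fin 3 => (t, s)) (Prod.mk_right_injective t)
        exact h1.comp (fun s x => ‖x + a (t, s)‖ₑ ^ (-(2 / 3) : ℝ)) (by fun_prop)
    _ ≤ ((m : ℝ≥0∞) ^ 2)⁻¹ * ∑ _t : Fin m, K ^ 3 := by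
        gcongr with t
        refine (Finset.prod_le_prod' (g := fun _ => K) fun s _ => ?_).trans_eq (by simp)
        rw [← lintegral_map (f := fun x => ‖x + a (t, s)‖ₑ ^ (-(2 / 3) : ℝ)) (by fun_prop) (hG _),
          hlaw]
        exact hK _
    _ = K ^ 3 / m := by
        rw [Finset.sum_const, Finset.card_univ, Fintype.card_fin, nsmul_eq_mul, ← mul_assoc,
          sq, ENNReal.mul_inv (Or.inl hm0) (Or.inl (by simp)), mul_assoc (m : ℝ≥0∞)⁻¹,
          ENNReal.inv_mul_cancel hm0 (by simp), mul_one, mul_comm, div_eq_mul_inv]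

/-! ### Residual sums of squares and the inverse Gram matrix -/

/-- The residual sum of squares of the least squares regression of `y` on the columns of `B`. The
infimum runs over rational coefficients, which makes its measurability plain. -/
noncomputable def residualSS {n : ℕ} {κ : Type*} [Fintype κ] (B : Matrix (Fin n) κ ℝ)
    (y : Fin n → ℝ) : ℝ≥0∞ :=
  ⨅ w : κ → ℚ, ENNReal.ofReal (∑ i, (y i - ∑ k, B i k * w k) ^ 2)

/-- Rational vectors are dense and the sum of squares is continuous in the coefficients, so real
coefficients do no better than the rational infimum. -/
theorem residualSS_le {n : ℕ} {κ : Type*} [Fintype κ] (B : Matrix (Fin n) κ ℝ)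
    (y : Fin n → ℝ) (w : κ → ℝ) :
    residualSS B y ≤ ENNReal.ofReal (∑ i, (y i - ∑ k, B i k * w k) ^ 2) := by
  have hd : DenseRange (fun (q : κ → ℚ) (k : κ) => (q k : ℝ)) :=
    DenseRange.piMap fun _ => Rat.denseRange_cast
  have hcl : IsClosed {w : κ → ℝ |
      residualSS B y ≤ ENNReal.ofReal (∑ i, (y i - ∑ k, B i k * w k) ^ 2)} :=
    isClosed_le continuous_const (ENNReal.continuous_ofReal.comp (by fun_prop))
  exact hd.induction_on (p := fun w : κ → ℝ =>
    residualSS B y ≤ ENNReal.ofReal (∑ i, (y i - ∑ k, B i k * w k) ^ 2)) w hcl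
    fun q => iInf_le _ q

theorem measurable_residualSS {n : ℕ} {κ : Type*} [Fintype κ] {α : Type*} [MeasurableSpace α]
    {B : α → Matrix (Fin n) κ ℝ} {y : α → Fin n → ℝ} (hB : ∀ i k, Measurable fun x => B x i k)
    (hy : ∀ i, Measurable fun x => y x i) : Measurable fun x => residualSS (B x) (y x) := by
  unfold residualSS
  refine Measurable.iInf fun w => ENNReal.measurable_ofReal.comp ?_
  fun_prop

/-- Bessel's inequality for the residual of a regression. -/
theorem sum_le_residualSS {n : ℕ} {κ β : Type*} [Fintype κ] [Fintype β]
    (B : Matrix (Fin n) κ ℝ) (y : Fin n → ℝ) {u : β → EuclideanSpace ℝ (Fin n)}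
    (hu : Orthonormal ℝ u) (hB : ∀ b k, ∑ i, u b i * B i k = 0) :
    ∑ b, ‖∑ i, u b i * y i‖ₑ ^ 2 ≤ residualSS B y := by
  refine le_iInf fun w => ?_
  set r : EuclideanSpace ℝ (Fin n) := WithLp.toLp 2 fun i => y i - ∑ k, B i k * w k with hr
  -- Subtracting a combination of the columns leaves the inner products with `u b` unchanged, so
  -- Bessel's bound is the same for every `w`.
  have h1 : ∀ b, inner ℝ (u b) r = ∑ i, u b i * y i := fun b => by
    simp only [hr, PiLp.inner_apply, RCLike.inner_apply, conj_trivial, mul_comm (_ - _),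
      mul_sub, Finset.sum_sub_distrib, Finset.mul_sum]
    rw [Finset.sum_comm]
    simp only [← mul_assoc, ← Finset.sum_mul, hB, zero_mul, Finset.sum_const_zero, sub_zero]
  have h2 := hu.sum_inner_products_le r (s := Finset.univ)
  simp only [h1] at h2
  rw [EuclideanSpace.real_norm_sq_eq] at h2
  simp_rw [Real.enorm_eq_ofReal_abs, ← ENNReal.ofReal_pow (abs_nonneg _)]
  rw [← ENNReal.ofReal_sum_of_nonneg fun _ _ => by positivity]
  exact ENNReal.ofReal_le_ofReal (by simpa using h2)

/-- Few columns leave many orthonormal directions. -/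
theorem exists_orthonormal_orthogonal {n : ℕ} {κ β : Type*} [Fintype κ] [Fintype β]
    (B : Matrix (Fin n) κ ℝ) (h : Fintype.card β + Fintype.card κ ≤ n) :
    ∃ u : β → EuclideanSpace ℝ (Fin n), Orthonormal ℝ u ∧ ∀ b k, ∑ i, u b i * B i k = 0 := by
  set col : κ → EuclideanSpace ℝ (Fin n) := fun k => WithLp.toLp 2 fun i => B i k
  set V := Submodule.span ℝ (Set.range col)
  have hV : Module.finrank ℝ V ≤ Fintype.card κ := finrank_range_le_card col
  have hVo : Module.finrank ℝ V + Module.finrank ℝ Vᗮ = n := by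
    rw [Submodule.finrank_add_finrank_orthogonal, finrank_euclideanSpace_fin]
  have hc : Fintype.card β ≤ Module.finrank ℝ Vᗮ := by omega
  set e := stdOrthonormalBasis ℝ Vᗮ
  let g : β → Fin (Module.finrank ℝ Vᗮ) := fun b => Fin.castLE hc (Fintype.equivFin β b)
  have hg : Function.Injective g :=
    (Fin.castLE_injective hc).comp (Fintype.equivFin β).injective
  refine ⟨fun b => (e (g b) : EuclideanSpace ℝ (Fin n)), ?_, fun b k => ?_⟩
  · exact (e.orthonormal.comp_linearIsometry Vᗮ.subtypeₗᵢ).comp g hg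
  · have := (Submodule.mem_orthogonal V _).1 (e (g b)).2 (col k)
      (Submodule.subset_span ⟨k, rfl⟩)
    simpa [PiLp.inner_apply, col] using this

/-- Orthonormal linear forms of independent centered Gaussian variables with a common variance are
again such variables. -/
theorem orthonormal_forms_gaussian {n : ℕ} {β : Type*} [Fintype β] (v : ℝ≥0)
    {u : β → EuclideanSpace ℝ (Fin n)} (hu : Orthonormal ℝ u) :
    iIndepFun (fun b (z : Fin n → ℝ) => ∑ i, u b i * z i)
        (Measure.pi fun _ : Fin n => gaussianReal 0 v) ∧
      ∀ b, (Measure.pi fun _ : Fin n => gaussianReal 0 v).map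
        (fun z : Fin n → ℝ => ∑ i, u b i * z i) = gaussianReal 0 v := by
  set Q := Measure.pi fun _ : Fin n => gaussianReal 0 v with hQ
  have hev : ∀ i, Q.map (fun z : Fin n → ℝ => z i) = gaussianReal 0 v := fun i =>
    (measurePreserving_eval _ i).map_eq
  have hG1 : ∀ i, HasGaussianLaw (fun z : Fin n → ℝ => z i) Q := fun i =>
    ⟨by rw [hev]; infer_instance⟩
  have hm : ∀ i, AEMeasurable (fun z : Fin n → ℝ => z i) Q := fun i =>
    (measurable_pi_apply i).aemeasurable
  have hI : iIndepFun (fun i (z : Fin n → ℝ) => z i) Q :=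
    iIndepFun_pi (X := fun _ x => x) fun _ => aemeasurable_id
  have hG : HasGaussianLaw (fun z : Fin n → ℝ => (fun i => z i)) Q := hI.hasGaussianLaw hG1
  let Lb : (Fin n → ℝ) →L[ℝ] (β → ℝ) :=
    ContinuousLinearMap.pi fun b => ∑ i, (u b i) • ContinuousLinearMap.proj (R := ℝ) i
  have hGu : HasGaussianLaw (fun z : Fin n → ℝ => fun b => ∑ i, u b i * z i) Q := by
    have h : (fun (z : Fin n → ℝ) b => ∑ i, u b i * z i) = fun z => Lb z := by
      funext z b
      simp [Lb]
    exact h ▸ hG.map_fun Lb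
  have hL2 : ∀ i, MemLp (fun z : Fin n → ℝ => z i) 2 Q := fun i => (hG1 i).memLp_two
  have hvar : ∀ i, Var[fun z : Fin n → ℝ => z i; Q] = v := fun i => by
    have h := variance_map (μ := Q) (X := id) (Y := fun z : Fin n → ℝ => z i)
      (by fun_prop) (hm i)
    rw [hev, variance_id_gaussianReal] at h
    exact h.symm
  have hmean : ∀ i, ∫ z : Fin n → ℝ, z i ∂Q = 0 := fun i => by
    have h := integral_map (μ := Q) (φ := fun z : Fin n → ℝ => z i) (f := fun x => x)
      (hm i) (by fun_prop)
    rw [hev, integral_id_gaussianReal] at h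
    exact h.symm
  -- The forms are jointly Gaussian with covariance `v` times the Gram matrix of `u`, that is `v`
  -- times the identity; uncorrelated then means independent.
  have hcov : ∀ b c, cov[fun z : Fin n → ℝ => ∑ i, u b i * z i,
      fun z => ∑ i, u c i * z i; Q] = v * inner ℝ (u b) (u c) := fun b c => by
    rw [covariance_fun_sum_fun_sum (fun i => (hL2 i).const_mul _)
      (fun i => (hL2 i).const_mul _)]
    simp_rw [covariance_const_mul_left, covariance_const_mul_right]
    have : ∀ i k : Fin n, cov[fun z : Fin n → ℝ => z i, fun z => z k; Q]
        = if i = k then (v : ℝ) else 0 := fun i k => by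
      split_ifs with h
      · subst h
        rw [covariance_self (hm i), hvar]
      · exact (hI.indepFun h).covariance_eq_zero (hL2 i) (hL2 k)
    simp [this, PiLp.inner_apply, Finset.mul_sum]
    exact Finset.sum_congr rfl fun i _ => by ring
  refine ⟨hGu.iIndepFun_of_covariance_eq_zero fun b c hbc => ?_, fun b => ?_⟩
  · rw [hcov, hu.2 hbc, mul_zero]
  · rw [(hGu.eval b).map_eq_gaussianReal, ← covariance_self
      (Finset.aemeasurable_fun_sum _ fun i _ => (hm i).const_mul _), hcov]
    congr 1
    · rw [integral_finsetSum _ fun i _ => (hG1 i).integrable.const_mul _]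
      simp [integral_const_mul, hmean]
    · simp [hu.1 b]

/-- The mean inverse residual sum of squares of a Gaussian response is of order `1/m` when there
are `3m` residual degrees of freedom. -/
theorem lintegral_inv_residualSS_le {v : ℝ≥0} {K : ℝ≥0∞}
    (hK : ∀ a : ℝ, ∫⁻ x, ‖x + a‖ₑ ^ (-(2 / 3) : ℝ) ∂(gaussianReal 0 v) ≤ K)
    {n m : ℕ} (hm : 0 < m) {κ : Type*} [Fintype κ] (hn : 3 * m + Fintype.card κ ≤ n)
    (B : Matrix (Fin n) κ ℝ) (a : Fin n → ℝ) :
    ∫⁻ z, (residualSS B (fun i => a i + z i))⁻¹ ∂(Measure.pi fun _ : Fin n => gaussianReal 0 v)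
      ≤ K ^ 3 / m := by
  -- Project on `3m` directions orthogonal to the columns of `B`. The shift `a` survives only as a
  -- noncentrality, over which the bound is uniform.
  obtain ⟨u, hu, huB⟩ := exists_orthonormal_orthogonal (β := Fin m × Fin 3) B
    (by simpa [mul_comm] using hn)
  obtain ⟨hI, hlaw⟩ := orthonormal_forms_gaussian v hu
  refine le_trans (lintegral_mono fun z => ?_) (lintegral_inv_sum_sq_gaussian_le hK hm
    (fun b (z : Fin n → ℝ) => ∑ i, u b i * z i) (by fun_prop) hlaw hI
    (fun b => ∑ i, u b i * a i))
  refine ENNReal.inv_le_inv.2 ((le_of_eq ?_).trans (sum_le_residualSS B _ hu huB))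
  refine Finset.sum_congr rfl fun b _ => ?_
  rw [← Finset.sum_add_distrib]
  congr 2
  exact Finset.sum_congr rfl fun i _ => by ring

/-- A diagonal entry of the inverse Gram matrix is at most the inverse of the residual sum of
squares of the corresponding column on the other ones. -/
theorem ofReal_gram_inv_le {n : ℕ} {ι : Type*} [Fintype ι] [DecidableEq ι]
    (A : Matrix (Fin n) ι ℝ) (l : ι) :
    ENNReal.ofReal ((Aᵀ * A)⁻¹ l l) ≤
      (residualSS (Matrix.of fun i (k : {k : ι // k ≠ l}) => A i k) fun i => A i l)⁻¹ := by
  -- A singular Gram matrix has inverse `0` by convention, and the left side is then `0`.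
  by_cases hdet : IsUnit (Aᵀ * A).det
  swap
  · rw [Matrix.nonsing_inv_apply_not_isUnit _ hdet]
    simp
  set G := (Aᵀ * A)⁻¹ with hG
  rcases le_or_gt (G l l) 0 with hc | hc
  · simp [ENNReal.ofReal_of_nonpos hc]
  have hAG : Aᵀ * A * G = 1 := Matrix.mul_nonsing_inv _ hdet
  -- Column `l` of `A * G`, divided by `G l l`, is column `l` of `A` minus a combination of the
  -- others, and its squared norm is `1 / G l l`. It is the true residual, but being one candidate
  -- is enough.
  have h1 : ∀ i, A i l - ∑ k : {k : ι // k ≠ l}, A i k * (-G k l / G l l)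
      = (A * G) i l / G l l := fun i => by
    have h2 := Fintype.sum_subtype_add_sum_subtype (fun k => k ≠ l) fun k => A i k * G k l
    have h3 : ∑ k : {k : ι // ¬ k ≠ l}, A i k * G k l = A i l * G l l := by
      have : Unique {k : ι // ¬ k ≠ l} :=
        ⟨⟨⟨l, by simp⟩⟩, fun k => Subtype.ext (not_not.1 k.2)⟩
      rw [Fintype.sum_unique]
      have : (default : {k : ι // ¬ k ≠ l}).1 = l := not_not.1 (default : {k : ι // ¬ k ≠ l}).2
      rw [this]
    rw [h3] at h2
    rw [Matrix.mul_apply, ← h2, add_div, mul_div_assoc, div_self hc.ne', Finset.sum_div]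
    simp only [neg_div, mul_neg, Finset.sum_neg_distrib, mul_div_assoc]
    ring
  have h4 : ∑ i, ((A * G) i l / G l l) ^ 2 = (G l l)⁻¹ := by
    have h5 : ∑ i, (A * G) i l ^ 2 = G l l := by
      have : (A * G)ᵀ * (A * G) = Gᵀ := by
        rw [Matrix.transpose_mul, Matrix.mul_assoc, ← Matrix.mul_assoc Aᵀ, hAG, Matrix.mul_one]
      have := congrFun (congrFun this l) l
      rw [Matrix.mul_apply] at this
      simpa [sq] using this
    simp_rw [div_pow]
    rw [← Finset.sum_div, h5]
    field_simp
  have h6 := residualSS_le (Matrix.of fun i (k : {k : ι // k ≠ l}) => A i k) (fun i => A i l)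
    fun k => -G k l / G l l
  simp only [Matrix.of_apply, h1, h4] at h6
  rw [ENNReal.ofReal_inv_of_pos hc] at h6
  simpa using ENNReal.inv_le_inv.2 h6

/-- The Gram matrix is invertible as soon as none of the columns in `L` is a combination of the
other columns and the columns outside `L` are independent. -/
theorem gram_det_ne_zero {n : ℕ} {ι : Type*} [Fintype ι] [DecidableEq ι]
    (A : Matrix (Fin n) ι ℝ) (L : Set ι)
    (hL : ∀ l ∈ L, residualSS (Matrix.of fun i (k : {k : ι // k ≠ l}) => A i k)
      (fun i => A i l) ≠ 0)
    (hLc : ∀ w : ι → ℝ, (∀ l ∈ L, w l = 0) → A *ᵥ w = 0 → w = 0) :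
    (Aᵀ * A).det ≠ 0 := by
  intro h0
  obtain ⟨w, hw0, hw⟩ := Matrix.exists_mulVec_eq_zero_iff.2 h0
  have hAw : A *ᵥ w = 0 := by
    have := Matrix.conjTranspose_mul_self_mulVec_eq_zero A w
    rw [Matrix.conjTranspose_eq_transpose_of_trivial] at this
    exact this.1 hw
  refine hw0 (hLc w (fun l hl => ?_) hAw)
  -- If `w l ≠ 0`, the relation `A w = 0` can be solved for column `l`, whose residual sum of
  -- squares is then zero.
  by_contra hwl
  refine hL l hl (le_antisymm ?_ zero_le)
  refine (residualSS_le (Matrix.of fun i (k : {k : ι // k ≠ l}) => A i k) (fun i => A i l)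
    fun k => -w k / w l).trans (le_of_eq ?_)
  rw [ENNReal.ofReal_eq_zero]
  refine le_of_eq (Finset.sum_eq_zero fun i _ => ?_)
  have h2 := Fintype.sum_subtype_add_sum_subtype (fun k => k ≠ l) fun k => A i k * w k
  have h3 : ∑ k : {k : ι // ¬ k ≠ l}, A i k * w k = A i l * w l := by
    have : Unique {k : ι // ¬ k ≠ l} :=
      ⟨⟨⟨l, by simp⟩⟩, fun k => Subtype.ext (not_not.1 k.2)⟩
    rw [Fintype.sum_unique]
    have : (default : {k : ι // ¬ k ≠ l}).1 = l := not_not.1 (default : {k : ι // ¬ k ≠ l}).2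
    rw [this]
  have h4 : ∑ k, A i k * w k = 0 := congrFun hAw i
  rw [h3, h4] at h2
  have h5 : ∑ k : {k : ι // k ≠ l}, A i k * (-w k / w l)
      = -(∑ k : {k : ι // k ≠ l}, A i k * w k) / w l := by
    simp only [neg_div, mul_neg, Finset.sum_neg_distrib, Finset.sum_div, mul_div_assoc]
  simp only [Matrix.of_apply, h5]
  rw [eq_neg_of_add_eq_zero_left h2]
  field_simp
  ring

/-! ### Gaussian designs -/

/-- Regression of one coordinate of a nondegenerate Gaussian vector on the other ones. -/
theorem exists_gaussian_regression {p : ℕ} (μ : EuclideanSpace ℝ (Fin p))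
    {S : Matrix (Fin p) (Fin p) ℝ} (hS : S.PosDef) (l : Fin p) :
    ∃ (c : ℝ) (γ : {k : Fin p // k ≠ l} → ℝ) (v : ℝ≥0), v ≠ 0 ∧ (μ = 0 → c = 0) ∧
      (multivariateGaussian μ S).map (fun x => x l - c - ∑ k, γ k * drop l x k)
        = gaussianReal 0 v ∧
      IndepFun (drop l) (fun x => x l - c - ∑ k, γ k * drop l x k)
        (multivariateGaussian μ S) := by
  set Q := multivariateGaussian μ S with hQ
  set Θ := S⁻¹ with hΘ
  have hθ : 0 < Θ l l := hS.inv.diag_pos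
  have hΘS : Θ * S = 1 := Matrix.nonsing_inv_mul _ hS.det_pos.ne'.isUnit
  -- The residual is read off row `l` of the precision matrix `Θ`, scaled so that `t l = 1`. From `Θ
  -- * S = 1`, the form `∑ t k * x k` is uncorrelated with every `x k`, `k ≠ l`, and has variance `1
  -- / Θ l l`. The slopes are `-t k`, and the intercept `C` is the mean of the form.
  set t : Fin p → ℝ := fun k => Θ l k / Θ l l with ht
  have htl : t l = 1 := div_self hθ.ne'
  set C := ∑ k, t k * μ k with hC
  have hsplit : ∀ x : Fin p → ℝ, ∑ k, t k * x k = x l + ∑ k : {k // k ≠ l}, t k * x k := fun x => by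
    have h2 := Fintype.sum_subtype_add_sum_subtype (fun k => k ≠ l) fun k => t k * x k
    have h3 : ∑ k : {k : Fin p // ¬ k ≠ l}, t k * x k = x l := by
      have : Unique {k : Fin p // ¬ k ≠ l} :=
        ⟨⟨⟨l, by simp⟩⟩, fun k => Subtype.ext (not_not.1 k.2)⟩
      rw [Fintype.sum_unique]
      have : (default : {k : Fin p // ¬ k ≠ l}).1 = l :=
        not_not.1 (default : {k : Fin p // ¬ k ≠ l}).2
      rw [this, htl, one_mul]
    rw [← h2, h3, add_comm]
  have hm : ∀ k, AEMeasurable (fun x : EuclideanSpace ℝ (Fin p) => x k) Q := fun k =>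
    (by fun_prop : Measurable fun x : EuclideanSpace ℝ (Fin p) => x k).aemeasurable
  have hid : HasGaussianLaw (fun x : EuclideanSpace ℝ (Fin p) => x) Q :=
    IsGaussian.hasGaussianLaw_id
  have hev : ∀ k, HasGaussianLaw (fun x : EuclideanSpace ℝ (Fin p) => x k) Q := fun k =>
    hid.map_fun (EuclideanSpace.proj k)
  have hL2 : ∀ k, MemLp (fun x : EuclideanSpace ℝ (Fin p) => x k) 2 Q := fun k =>
    (hev k).memLp_two
  have hmean : ∀ k, ∫ x : EuclideanSpace ℝ (Fin p), x k ∂Q = μ k := fun k => by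
    have h1 := ContinuousLinearMap.integral_comp_comm (EuclideanSpace.proj (𝕜 := ℝ) k)
      hid.integrable
    rw [integral_id_multivariateGaussian] at h1
    exact h1
  have hcov : ∀ i k, cov[fun x : EuclideanSpace ℝ (Fin p) => x i, fun x => x k; Q] = S i k :=
    fun i k => covariance_eval_multivariateGaussian hS.posSemidef i k
  set σ : EuclideanSpace ℝ (Fin p) → ℝ := fun x => ∑ k, t k * x k with hσ
  have hσL2 : MemLp σ 2 Q := memLp_finsetSum _ fun k _ => (hL2 k).const_mul _
  have hcσ : ∀ k, cov[σ, fun x => x k; Q] = if k = l then (Θ l l)⁻¹ else 0 := fun k => by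
    rw [hσ, covariance_fun_sum_left (fun i => (hL2 i).const_mul _) (hL2 k)]
    simp_rw [covariance_const_mul_left, hcov, ht, div_mul_eq_mul_div]
    rw [← Finset.sum_div]
    have := congrFun (congrFun hΘS l) k
    rw [Matrix.mul_apply] at this
    rw [this, Matrix.one_apply]
    by_cases h : k = l
    · simp [h]
    · simp [h, Ne.symm h]
  have hvσ : Var[σ; Q] = (Θ l l)⁻¹ := by
    rw [← covariance_self hσL2.aemeasurable]
    conv_lhs => rw [hσ]
    rw [covariance_comm, covariance_fun_sum_left (fun i => (hL2 i).const_mul _) hσL2]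
    simp_rw [covariance_const_mul_left, covariance_comm _ σ, hcσ]
    simp [htl]
  let Lb : EuclideanSpace ℝ (Fin p) →L[ℝ] (Unit → ℝ) × ({k : Fin p // k ≠ l} → ℝ) :=
    (ContinuousLinearMap.pi fun _ => ∑ k, t k • EuclideanSpace.proj (𝕜 := ℝ) k).prod
      (ContinuousLinearMap.pi fun k => EuclideanSpace.proj (𝕜 := ℝ) k.1)
  have hjoint : HasGaussianLaw (fun x : EuclideanSpace ℝ (Fin p) =>
      ((fun _ : Unit => σ x), fun k : {k : Fin p // k ≠ l} => x k)) Q := by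
    have h : (fun x : EuclideanSpace ℝ (Fin p) =>
      ((fun _ : Unit => σ x), fun k : {k : Fin p // k ≠ l} => x k)) = fun x => Lb x := by
      funext x
      simp [Lb, hσ]
    rw [h]
    exact hid.map_fun Lb
  have hind := hjoint.indepFun_of_covariance_eval fun _ k => by
    have := hcσ k
    rwa [if_neg k.2] at this
  have hσG : HasGaussianLaw σ Q := hjoint.fst.eval ()
  have hρ : (fun x : EuclideanSpace ℝ (Fin p) =>
      x l - (C) - ∑ k, (fun k : {k : Fin p // k ≠ l} => -t k) k * drop l x k)
      = fun x => σ x - C := by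
    funext x
    simp only [hσ, hsplit x, drop, neg_mul, Finset.sum_neg_distrib]
    ring
  refine ⟨C, fun k => -t k, (Θ l l)⁻¹.toNNReal, ?_, fun h => by simp [hC, h], ?_, ?_⟩
  · simpa using hθ
  · rw [hρ]
    have h1 : Q.map (fun x => σ x - C) = (Q.map σ).map (fun y => y - C) := by
      rw [AEMeasurable.map_map_of_aemeasurable (by fun_prop) hσL2.aemeasurable]
      rfl
    rw [h1, hσG.map_eq_gaussianReal, gaussianReal_map_sub_const, hvσ]
    congr 1
    rw [integral_finsetSum _ fun i _ => (hev i).integrable.const_mul _]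
    simp [integral_const_mul, hmean, hC]
  · rw [hρ]
    exact (hind.comp (φ := fun y => y () - C) (ψ := id) (by fun_prop) measurable_id).symm

/-- Independent samples of two independent quantities are independent. -/
theorem pi_map_prod_eq {n : ℕ} {E α β : Type*} [MeasurableSpace E] [MeasurableSpace α]
    [MeasurableSpace β] {N : Measure E} [IsProbabilityMeasure N] {a : E → α} {b : E → β}
    (ha : Measurable a) (hb : Measurable b) (h : IndepFun a b N) :
    (Measure.pi fun _ : Fin n => N).map (fun D => ((fun i => a (D i)), fun i => b (D i)))
      = (Measure.pi fun _ : Fin n => N.map a).prod (Measure.pi fun _ : Fin n => N.map b) := by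
  have := Measure.isProbabilityMeasure_map (μ := N) ha.aemeasurable
  have := Measure.isProbabilityMeasure_map (μ := N) hb.aemeasurable
  have h1 := (indepFun_iff_map_prod_eq_prod_map_map ha.aemeasurable hb.aemeasurable).1 h
  have h2 := measurePreserving_arrowProdEquivProdArrow α β (Fin n) (fun _ => N.map a)
    fun _ => N.map b
  rw [← h2.map_eq]
  simp_rw [← h1]
  rw [← Measure.pi_map_pi fun _ => (ha.prodMk hb).aemeasurable,
    Measure.map_map (MeasurableEquiv.measurable _) (by fun_prop)]
  rfl

theorem indepFun_pi_comp {n : ℕ} {E α β : Type*} [MeasurableSpace E] [MeasurableSpace α]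
    [MeasurableSpace β] {N : Measure E} [IsProbabilityMeasure N] {a : E → α} {b : E → β}
    (ha : Measurable a) (hb : Measurable b) (h : IndepFun a b N) :
    IndepFun (fun (D : Fin n → E) i => a (D i)) (fun D i => b (D i))
      (Measure.pi fun _ : Fin n => N) := by
  rw [indepFun_iff_map_prod_eq_prod_map_map
    (by fun_prop : Measurable fun (D : Fin n → E) i => a (D i)).aemeasurable
    (by fun_prop : Measurable fun (D : Fin n → E) i => b (D i)).aemeasurable, pi_map_prod_eq ha hb h,
    Measure.pi_map_pi fun _ => ha.aemeasurable, Measure.pi_map_pi fun _ => hb.aemeasurable]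

/-- The design matrix with one row per covariate vector and regressors indexed by `ι`: the regressor
`k` is the covariate `t` if `f k = some t`, and the constant `1` if `f k = none`. -/
def design {p n : ℕ} {ι : Type*} (f : ι → Option (Fin p))
    (D : Fin n → EuclideanSpace ℝ (Fin p)) : Matrix (Fin n) ι ℝ :=
  Matrix.of fun i k => (f k).elim 1 fun t => D i t

theorem measurable_design {p n : ℕ} {ι : Type*} (f : ι → Option (Fin p)) (i : Fin n) (k : ι) :
    Measurable fun D : Fin n → EuclideanSpace ℝ (Fin p) => design f D i k := by
  unfold design
  rcases h : f k with _ | t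
  · simp [h]
  · simp only [Matrix.of_apply, h, Option.elim_some]
    fun_prop

/-- Condition on all covariates except `t`. As `f` is injective, `t` enters column `l` only, so the
other columns are fixed while column `l` is a fixed shift plus i.i.d. Gaussian noise. The
conditional bound does not depend on what is fixed. -/
theorem lintegral_inv_residualSS_design_le {p : ℕ} (μ : EuclideanSpace ℝ (Fin p))
    {S : Matrix (Fin p) (Fin p) ℝ} (hS : S.PosDef) {ι : Type*} [Fintype ι] [DecidableEq ι]
    {f : ι → Option (Fin p)} (hf : Function.Injective f) {l : ι} {t : Fin p}
    (hl : f l = some t) :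
    ∃ C : ℝ≥0∞, C ≠ ∞ ∧ ∀ n : ℕ, 2 * Fintype.card ι + 6 ≤ n →
      ∫⁻ D, (residualSS (Matrix.of fun i (k : {k : ι // k ≠ l}) => design f D i k)
        fun i => design f D i l)⁻¹ ∂(Measure.pi fun _ : Fin n => multivariateGaussian μ S)
        ≤ C / n := by
  obtain ⟨c, γ, v, hv, -, hρ, hind⟩ := exists_gaussian_regression μ hS t
  obtain ⟨K, hK, hKle⟩ := exists_lintegral_gaussianReal_rpow_le hv
  refine ⟨K ^ 3 * 6, ENNReal.mul_ne_top (ENNReal.pow_ne_top hK) (by simp), fun n hn => ?_⟩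
  -- The number of disjoint triples of residual directions. The lower bound on `n` ensures `n ≤ 6 *
  -- m`, the origin of the factor `6`.
  set m := (n - Fintype.card ι) / 3 with hm
  set ρ : EuclideanSpace ℝ (Fin p) → ℝ := fun x => x t - c - ∑ k, γ k * drop t x k with hρd
  have hρm : Measurable ρ := by
    have := measurable_drop t
    fun_prop
  set U := Fin n → {s : Fin p // s ≠ t} → ℝ
  -- The value `0` for covariate `t` is never met: no column other than `l` carries `t`.
  let B : U → Matrix (Fin n) {k : ι // k ≠ l} ℝ := fun u =>
    Matrix.of fun i k => (f k).elim 1 fun s => if h : s ≠ t then u i ⟨s, h⟩ else 0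
  let a : U → Fin n → ℝ := fun u i => c + ∑ k, γ k * u i k
  let F : U × (Fin n → ℝ) → ℝ≥0∞ := fun q =>
    (residualSS (B q.1) fun i => a q.1 i + q.2 i)⁻¹
  have hF : Measurable F := by
    refine (measurable_residualSS (fun i k => ?_) fun i => ?_).inv
    · rcases h : f k with _ | s
      · simp [B, h]
      · by_cases hs : s ≠ t
        · simp only [B, h, Matrix.of_apply, Option.elim_some, hs, ne_eq, not_false_eq_true,
            dite_true]
          fun_prop
        · obtain rfl := not_not.1 hs
          simp [B, h]
    · fun_prop
  have hDF : ∀ D : Fin n → EuclideanSpace ℝ (Fin p),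
      (residualSS (Matrix.of fun i (k : {k : ι // k ≠ l}) => design f D i k)
        fun i => design f D i l)⁻¹ = F ((fun i => drop t (D i)), fun i => ρ (D i)) := fun D => by
    simp only [F]
    congr 2
    · ext i k
      have hk : f k ≠ some t := fun h => k.2 (hf (h.trans hl.symm))
      rcases h : f k with _ | s
      · simp [B, h, design]
      · have hs : s ≠ t := fun hs => hk (by rw [h, hs])
        simp [B, h, design, hs, drop]
    · funext i
      simp [design, hl, a, hρd]
  have hmpos : 0 < m := by omega
  simp_rw [hDF]
  rw [← lintegral_map (f := F) (g := fun D : Fin n → EuclideanSpace ℝ (Fin p) =>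
    ((fun i => drop t (D i)), fun i => ρ (D i))) hF
    (by have := measurable_drop t; fun_prop), pi_map_prod_eq (measurable_drop t) hρm hind, hρ]
  have := Measure.isProbabilityMeasure_map (μ := multivariateGaussian μ S)
    (measurable_drop t).aemeasurable
  rw [lintegral_prod _ hF.aemeasurable]
  calc _ ≤ ∫⁻ u, K ^ 3 / m ∂(Measure.pi fun _ : Fin n => (multivariateGaussian μ S).map (drop t)) :=
        lintegral_mono fun u => lintegral_inv_residualSS_le hKle hmpos
          (by
            have : Fintype.card {k : ι // k ≠ l} ≤ Fintype.card ι := Fintype.card_subtype_le _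
            omega) (B u) (a u)
    _ = K ^ 3 / m := by simp
    _ ≤ K ^ 3 * 6 / n := by
        rw [div_eq_mul_inv, div_eq_mul_inv, mul_assoc]
        gcongr
        have h6 : (n : ℝ≥0∞) ≤ 6 * m := by exact_mod_cast (by omega : n ≤ 6 * m)
        rw [ENNReal.inv_le_iff_le_mul (fun _ => by simp [hmpos.ne']) (by simp)]
        have hn0 : (n : ℝ≥0∞) ≠ 0 := by exact_mod_cast (by omega : n ≠ 0)
        calc (1 : ℝ≥0∞) = n * (n : ℝ≥0∞)⁻¹ := (ENNReal.mul_inv_cancel hn0 (by simp)).symm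
          _ ≤ 6 * m * (n : ℝ≥0∞)⁻¹ := by gcongr
          _ = _ := by ring

theorem measurable_gram_inv {α : Type*} [MeasurableSpace α] {n : ℕ} {ι : Type*} [Fintype ι]
    [DecidableEq ι] {A : α → Matrix (Fin n) ι ℝ} (hA : ∀ i k, Measurable fun x => A x i k)
    (k l : ι) : Measurable fun x => ((A x)ᵀ * A x)⁻¹ k l := by
  have hM : ∀ k l, Measurable fun x => ((A x)ᵀ * A x) k l := fun k l => by
    simp only [Matrix.mul_apply, Matrix.transpose_apply]
    fun_prop
  have hdet : ∀ B : α → Matrix ι ι ℝ, (∀ k l, Measurable fun x => B x k l) →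
      Measurable fun x => (B x).det := fun B hB => by
    simp only [Matrix.det_apply']
    fun_prop
  have hadj : Measurable fun x => ((A x)ᵀ * A x).adjugate k l := by
    simp only [Matrix.adjugate_apply]
    refine hdet _ fun i j => ?_
    simp only [Matrix.updateRow_apply]
    split_ifs
    · exact measurable_const
    · exact hM i j
  simp only [Matrix.inv_def, Matrix.smul_apply, smul_eq_mul, Ring.inverse_eq_inv']
  exact (hdet _ hM).inv.mul hadj

/-- A Gaussian design has an almost surely invertible Gram matrix. The constant regressor is
allowed. -/
theorem ae_design_gram_det_ne_zero {p : ℕ} (μ : EuclideanSpace ℝ (Fin p))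
    {S : Matrix (Fin p) (Fin p) ℝ} (hS : S.PosDef) {ι : Type*} [Fintype ι] [DecidableEq ι]
    {f : ι → Option (Fin p)} (hf : Function.Injective f) {n : ℕ}
    (hn : 2 * Fintype.card ι + 6 ≤ n) :
    ∀ᵐ D ∂(Measure.pi fun _ : Fin n => multivariateGaussian μ S),
      ((design f D)ᵀ * design f D).det ≠ 0 := by
  have h : ∀ l : {l : ι // f l ≠ none},
      ∀ᵐ D ∂(Measure.pi fun _ : Fin n => multivariateGaussian μ S),
        residualSS (Matrix.of fun i (k : {k : ι // k ≠ l}) => design f D i k)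
          (fun i => design f D i l) ≠ 0 := fun l => by
    obtain ⟨t, ht⟩ := Option.ne_none_iff_exists'.1 l.2
    obtain ⟨C, hC, hle⟩ := lintegral_inv_residualSS_design_le μ hS hf ht
    -- A finite mean of the inverse makes the residual sum of squares almost surely nonzero.
    have hfin := ((hle n hn).trans_lt (ENNReal.div_lt_top hC
      (by exact_mod_cast (by omega : n ≠ 0)))).ne
    have hmeas : Measurable fun D : Fin n → EuclideanSpace ℝ (Fin p) =>
        (residualSS (Matrix.of fun i (k : {k : ι // k ≠ l.1}) => design f D i k)
          fun i => design f D i l)⁻¹ :=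
      (measurable_residualSS
        (B := fun D => Matrix.of fun i (k : {k : ι // k ≠ l.1}) => design f D i k)
        (fun i k => measurable_design f i k) fun i => measurable_design f i l).inv
    filter_upwards [ae_lt_top hmeas hfin] with D hD
    exact ENNReal.inv_lt_top.1 hD |>.ne'
  filter_upwards [ae_all_iff.2 h] with D hD
  refine gram_det_ne_zero _ {l | f l ≠ none} (fun l hl => hD ⟨l, hl⟩) fun w hw hAw => ?_
  funext k
  by_cases hk : f k = none
  · have h1 := congrFun hAw ⟨0, by omega⟩
    rw [Matrix.mulVec, dotProduct, Finset.sum_eq_single k (fun l _ hl => ?_) (by simp)] at h1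
    · simpa [design, hk] using h1
    · rw [hw l fun h => hl (hf (h.trans hk.symm)), mul_zero]
  · exact hw k hk

/-! ### Moments of the least squares errors -/

/-- Least squares is unbiased, and its mean square error is controlled by the mean of the inverse
Gram matrix. -/
theorem ols_unbiased {E ι : Type*} [MeasurableSpace E] [Fintype ι] [DecidableEq ι]
    {N : Measure E} [IsProbabilityMeasure N] {R : E → ι → ℝ} {η : E → ℝ}
    (hR : Measurable R) (hη : Measurable η) (hind : IndepFun R η N) {v : ℝ≥0}
    (hlaw : N.map η = gaussianReal 0 v) (θ : ι → ℝ) {n : ℕ}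
    (hdet : ∀ᵐ D ∂(Measure.pi fun _ : Fin n => N),
      ((Matrix.of fun i l => R (D i) l)ᵀ * (Matrix.of fun i l => R (D i) l)).det ≠ 0)
    (k : ι) {C : ℝ} (hC0 : 0 ≤ C)
    (hC : ∫⁻ D, ENNReal.ofReal
      (((Matrix.of fun i l => R (D i) l)ᵀ * (Matrix.of fun i l => R (D i) l))⁻¹ k k)
      ∂(Measure.pi fun _ : Fin n => N) ≤ ENNReal.ofReal C) :
    MemLp (fun D : Fin n → E => ols (Matrix.of fun i l => R (D i) l)
        (fun i => ∑ l, R (D i) l * θ l + η (D i)) k - θ k) 2 (Measure.pi fun _ : Fin n => N) ∧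
      ∫ D : Fin n → E, (ols (Matrix.of fun i l => R (D i) l)
        (fun i => ∑ l, R (D i) l * θ l + η (D i)) k - θ k) ∂(Measure.pi fun _ : Fin n => N) = 0 ∧
      ∫ D : Fin n → E, (ols (Matrix.of fun i l => R (D i) l)
        (fun i => ∑ l, R (D i) l * θ l + η (D i)) k - θ k) ^ 2
          ∂(Measure.pi fun _ : Fin n => N) ≤ v * C := by
  set Q := Measure.pi fun _ : Fin n => N with hQ
  set A : (Fin n → E) → Matrix (Fin n) ι ℝ := fun D => Matrix.of fun i l => R (D i) l with hA
  -- The weights of the estimator: the error in coordinate `k` is `∑ W i * η i`. They depend on the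
  -- regressors alone, hence are independent of the noise, and their squares sum to the `k`-th
  -- diagonal entry of the inverse Gram matrix.
  let W : (Fin n → ι → ℝ) → Fin n → ℝ := fun B i =>
    (((Matrix.of B)ᵀ * Matrix.of B)⁻¹ * (Matrix.of B)ᵀ) k i
  have hW : ∀ i, Measurable fun B => W B i := fun i => by
    simp only [W, Matrix.mul_apply, Matrix.transpose_apply]
    refine Finset.measurable_fun_sum _ fun l _ => Measurable.mul ?_ ?_
    · exact measurable_gram_inv (A := fun B : Fin n → ι → ℝ => Matrix.of B)
        (fun i k => (by fun_prop : Measurable fun B : Fin n → ι → ℝ => B i k)) k l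
    · exact (by fun_prop : Measurable fun B : Fin n → ι → ℝ => B i l)
  have hWw : ∀ D, ((A D)ᵀ * A D).det ≠ 0 →
      ∑ i, W (fun i => R (D i)) i ^ 2 = ((A D)ᵀ * A D)⁻¹ k k := fun D hD => by
    have hAG := Matrix.nonsing_inv_mul ((A D)ᵀ * A D) hD.isUnit
    set G := ((A D)ᵀ * A D)⁻¹ with hG
    have h1 : (G * (A D)ᵀ) * (G * (A D)ᵀ)ᵀ = Gᵀ := by
      rw [Matrix.transpose_mul, Matrix.transpose_transpose, Matrix.mul_assoc,
        ← Matrix.mul_assoc (A D)ᵀ, ← Matrix.mul_assoc, hAG, Matrix.one_mul]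
    have h2 := congrFun (congrFun h1 k) k
    rw [Matrix.mul_apply] at h2
    simpa [sq] using h2
  have herr : ∀ D, ((A D)ᵀ * A D).det ≠ 0 →
      ols (A D) (fun i => ∑ l, R (D i) l * θ l + η (D i)) k - θ k
        = ∑ i, W (fun i => R (D i)) i * η (D i) := fun D hD => by
    have h1 : (fun i => ∑ l, R (D i) l * θ l + η (D i)) = A D *ᵥ θ + fun i => η (D i) := rfl
    rw [ols, h1, Matrix.mulVec_add, Matrix.mulVec_add, Matrix.mulVec_mulVec, Matrix.mulVec_mulVec,
      Matrix.mul_assoc, Matrix.nonsing_inv_mul _ hD.isUnit, Matrix.one_mulVec, Matrix.mulVec_mulVec, Pi.add_apply,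
      add_sub_cancel_left]
    rfl
  have hindQ : IndepFun (fun (D : Fin n → E) i => R (D i)) (fun D i => η (D i)) Q :=
    indepFun_pi_comp hR hη hind
  have hηid : ∀ i, IdentDistrib (fun D : Fin n → E => η (D i)) η Q N := fun i => by
    refine ⟨(by fun_prop : Measurable fun D : Fin n → E => η (D i)).aemeasurable,
      hη.aemeasurable, ?_⟩
    rw [← (measurePreserving_eval (fun _ : Fin n => N) i).map_eq,
      Measure.map_map hη (measurable_pi_apply i)]
    rfl
  have hηN : IdentDistrib η id N (gaussianReal 0 v) :=
    ⟨hη.aemeasurable, aemeasurable_id, by rw [hlaw, Measure.map_id]⟩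
  have hηg : ∀ i, IdentDistrib (fun D : Fin n → E => η (D i)) id Q (gaussianReal 0 v) :=
    fun i => (hηid i).trans hηN
  have hηL2 : ∀ i, MemLp (fun D : Fin n → E => η (D i)) 2 Q := fun i =>
    (hηg i).symm.memLp_snd (memLp_id_gaussianReal 2)
  have hη0 : ∀ i, ∫ D : Fin n → E, η (D i) ∂Q = 0 := fun i => by
    rw [(hηg i).integral_eq]
    simp
  have hη2 : ∀ i, ∫ D : Fin n → E, η (D i) * η (D i) ∂Q = v := fun i => by
    have h1 := (hηg i).variance_eq
    rw [variance_id_gaussianReal, variance_of_integral_eq_zero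
      (hηL2 i).aestronglyMeasurable.aemeasurable (hη0 i)] at h1
    simpa [sq] using h1
  have hηI : iIndepFun (fun i (D : Fin n → E) => η (D i)) Q :=
    iIndepFun_pi fun _ => hη.aemeasurable
  have hηij : ∀ i i', ∫ D : Fin n → E, η (D i) * η (D i') ∂Q = if i = i' then (v : ℝ) else 0 :=
    fun i i' => by
      split_ifs with h
      · subst h
        exact hη2 i
      · rw [(hηI.indepFun h).integral_fun_mul_eq_mul_integral (hηL2 i).aestronglyMeasurable
          (hηL2 i').aestronglyMeasurable, hη0, zero_mul]
  have hwm : ∀ i, Measurable fun D : Fin n → E => W (fun i => R (D i)) i := fun i =>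
    (hW i).comp (by fun_prop)
  have hsum : ∫⁻ D, ENNReal.ofReal (∑ i, W (fun i => R (D i)) i ^ 2) ∂Q ≤ ENNReal.ofReal C := by
    refine le_trans (le_of_eq (lintegral_congr_ae ?_)) hC
    filter_upwards [hdet] with D hD
    rw [hWw D hD]
  have hsumI : Integrable (fun D : Fin n → E => ∑ i, W (fun i => R (D i)) i ^ 2) Q := by
    refine ⟨(by fun_prop : Measurable _).aestronglyMeasurable, ?_⟩
    rw [hasFiniteIntegral_iff_ofReal (Filter.Eventually.of_forall fun D =>
      Finset.sum_nonneg fun i _ => sq_nonneg _)]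
    exact hsum.trans_lt ENNReal.ofReal_lt_top
  have hsumC : ∫ D : Fin n → E, ∑ i, W (fun i => R (D i)) i ^ 2 ∂Q ≤ C := by
    rw [integral_eq_lintegral_of_nonneg_ae (Filter.Eventually.of_forall fun D =>
      Finset.sum_nonneg fun i _ => sq_nonneg _) hsumI.aestronglyMeasurable]
    exact ENNReal.toReal_le_of_le_ofReal hC0 hsum
  have hwL2 : ∀ i, MemLp (fun D : Fin n → E => W (fun i => R (D i)) i) 2 Q := fun i => by
    rw [memLp_two_iff_integrable_sq (hwm i).aestronglyMeasurable]
    refine hsumI.mono' ((hwm i).pow_const 2).aestronglyMeasurable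
      (Filter.Eventually.of_forall fun D => ?_)
    rw [Real.norm_of_nonneg (sq_nonneg _)]
    exact Finset.single_le_sum (f := fun i => W (fun i => R (D i)) i ^ 2)
      (fun _ _ => sq_nonneg _) (Finset.mem_univ i)
  have hi2 : ∀ i i', IndepFun
      (fun D : Fin n → E => W (fun i => R (D i)) i * W (fun i => R (D i)) i')
      (fun D => η (D i) * η (D i')) Q := fun i i' =>
    hindQ.comp (φ := fun B : Fin n → ι → ℝ => W B i * W B i')
      (ψ := fun z : Fin n → ℝ => z i * z i')
      ((hW i).mul (hW i')) (by fun_prop)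
  have hi1 : ∀ i, IndepFun (fun D : Fin n → E => W (fun i => R (D i)) i)
      (fun D => η (D i)) Q := fun i =>
    hindQ.comp (φ := fun B : Fin n → ι → ℝ => W B i) (ψ := fun z : Fin n → ℝ => z i) (hW i) (by fun_prop)
  have hprodI : ∀ i i', Integrable (fun D : Fin n → E =>
      (W (fun i => R (D i)) i * W (fun i => R (D i)) i') * (η (D i) * η (D i'))) Q := fun i i' =>
    (hi2 i i').integrable_mul ((hwL2 i).integrable_mul (hwL2 i'))
      ((hηL2 i).integrable_mul (hηL2 i'))
  -- The square is a product of independent integrable variables, so no fourth moments are needed.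
  have hterm : ∀ i, MemLp (fun D : Fin n → E => W (fun i => R (D i)) i * η (D i)) 2 Q := fun i => by
    rw [memLp_two_iff_integrable_sq (by fun_prop :
      Measurable fun D : Fin n → E => W (fun i => R (D i)) i * η (D i)).aestronglyMeasurable]
    refine (hprodI i i).congr (Filter.Eventually.of_forall fun D => ?_)
    simp only
    ring
  have hae : (fun D : Fin n → E => ols (A D) (fun i => ∑ l, R (D i) l * θ l + η (D i)) k - θ k)
      =ᵐ[Q] fun D => ∑ i, W (fun i => R (D i)) i * η (D i) := by
    filter_upwards [hdet] with D hD using herr D hD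
  refine ⟨(memLp_congr_ae hae).2 (memLp_finsetSum _ fun i _ => hterm i), ?_, ?_⟩
  · rw [integral_congr_ae hae, integral_finsetSum _ fun i _ =>
      (hterm i).integrable (by norm_num)]
    refine Finset.sum_eq_zero fun i _ => ?_
    rw [(hi1 i).integral_fun_mul_eq_mul_integral (hwm i).aestronglyMeasurable
      (hηL2 i).aestronglyMeasurable, hη0, mul_zero]
  · have h1 : ∫ D : Fin n → E, (ols (A D) (fun i => ∑ l, R (D i) l * θ l + η (D i)) k - θ k) ^ 2 ∂Q
        = ∫ D : Fin n → E, ∑ i, ∑ i', (W (fun i => R (D i)) i * W (fun i => R (D i)) i')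
          * (η (D i) * η (D i')) ∂Q := by
      refine integral_congr_ae ?_
      filter_upwards [hdet] with D hD
      rw [herr D hD, sq, Finset.sum_mul_sum]
      exact Finset.sum_congr rfl fun i _ => Finset.sum_congr rfl fun i' _ => by ring
    rw [h1, integral_finsetSum _ fun i _ => integrable_finsetSum _ fun i' _ => hprodI i i']
    simp_rw [integral_finsetSum _ fun i' _ => hprodI _ i']
    -- Distinct noise terms are independent and centered, so only the diagonal survives.
    have h2 : ∀ i i', ∫ D : Fin n → E, (W (fun i => R (D i)) i * W (fun i => R (D i)) i')
          * (η (D i) * η (D i')) ∂Q = if i = i' then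
            v * ∫ D : Fin n → E, W (fun i => R (D i)) i ^ 2 ∂Q else 0 := fun i i' => by
      rw [(hi2 i i').integral_fun_mul_eq_mul_integral
        ((hwL2 i).integrable_mul (hwL2 i')).aestronglyMeasurable
        ((hηL2 i).integrable_mul (hηL2 i')).aestronglyMeasurable, hηij]
      split_ifs with h
      · subst h
        simp only [sq]
        ring
      · simp
    simp_rw [h2]
    simp only [Finset.sum_ite_eq, Finset.mem_univ, if_true]
    rw [← Finset.mul_sum, ← integral_finsetSum _ fun i _ => (hwL2 i).integrable_sq]
    exact mul_le_mul_of_nonneg_left hsumC v.2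

theorem measurable_ols {α : Type*} [MeasurableSpace α] {n : ℕ} {ι : Type*} [Fintype ι]
    [DecidableEq ι] {A : α → Matrix (Fin n) ι ℝ} {b : α → Fin n → ℝ}
    (hA : ∀ i k, Measurable fun x => A x i k) (hb : ∀ i, Measurable fun x => b x i) (k : ι) :
    Measurable fun x => ols (A x) (b x) k := by
  simp only [ols, Matrix.mulVec, dotProduct, Matrix.transpose_apply]
  refine Finset.measurable_fun_sum _ fun l _ => (measurable_gram_inv hA k l).mul ?_
  fun_prop

/-- The moments of the least squares error for a Gaussian design, at the rate `1/n`. -/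
theorem exists_design_ols_moments {p : ℕ} {P₀ : Measure (Obs p)} [IsProbabilityMeasure P₀]
    {μ : EuclideanSpace ℝ (Fin p)} {S : Matrix (Fin p) (Fin p) ℝ} (hS : S.PosDef)
    (hX : P₀.map Prod.fst = multivariateGaussian μ S)
    {ι : Type*} [Fintype ι] [DecidableEq ι] {f : ι → Option (Fin p)} (hf : Function.Injective f)
    {η : Obs p → ℝ} (hη : Measurable η) {v : ℝ≥0} (hlaw : P₀.map η = gaussianReal 0 v)
    (hind : IndepFun (fun (z : Obs p) (k : ι) => (f k).elim 1 fun t => z.1 t) η P₀)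
    (θ : ι → ℝ) {y : Obs p → ℝ}
    (hy : ∀ z : Obs p, y z = ∑ k, ((f k).elim 1 fun t => z.1 t) * θ k + η z)
    {l : ι} {t : Fin p} (hl : f l = some t) :
    ∃ C : ℝ, 0 ≤ C ∧ ∀ n : ℕ, 2 * Fintype.card ι + 6 ≤ n →
      MemLp (fun D : Fin n → Obs p => ols (design f fun i => (D i).1) (fun i => y (D i)) l - θ l) 2
        (Measure.pi fun _ : Fin n => P₀) ∧
      ∫ D : Fin n → Obs p, (ols (design f fun i => (D i).1) (fun i => y (D i)) l - θ l)
        ∂(Measure.pi fun _ : Fin n => P₀) = 0 ∧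
      ∫ D : Fin n → Obs p, (ols (design f fun i => (D i).1) (fun i => y (D i)) l - θ l) ^ 2
        ∂(Measure.pi fun _ : Fin n => P₀) ≤ C / n := by
  obtain ⟨K, hK, hle⟩ := lintegral_inv_residualSS_design_le μ hS hf hl
  refine ⟨v * K.toReal, by positivity, fun n hn => ?_⟩
  have hR : Measurable fun (z : Obs p) (k : ι) => (f k).elim (1 : ℝ) fun t => z.1 t := by
    refine measurable_pi_lambda _ fun k => ?_
    rcases f k with _ | s
    · exact measurable_const
    · simp only [Option.elim_some]
      fun_prop
  have hn0 : (n : ℝ≥0∞) ≠ 0 := by exact_mod_cast (by omega : n ≠ 0)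
  have hmap : (Measure.pi fun _ : Fin n => P₀).map (fun D i => (D i).1)
      = Measure.pi fun _ : Fin n => multivariateGaussian μ S := by
    have := Measure.isProbabilityMeasure_map (μ := P₀) measurable_fst.aemeasurable
    rw [← hX, ← Measure.pi_map_pi fun _ => measurable_fst.aemeasurable]
  have hfm : Measurable fun (D : Fin n → Obs p) i => (D i).1 := by fun_prop
  have hdet : ∀ᵐ D ∂(Measure.pi fun _ : Fin n => P₀),
      ((design f fun i => (D i).1)ᵀ * design f fun i => (D i).1).det ≠ 0 := by
    have := ae_design_gram_det_ne_zero μ hS hf hn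
    rw [← hmap] at this
    exact ae_of_ae_map hfm.aemeasurable this
  have hC : ∫⁻ D, ENNReal.ofReal
      (((design f fun i => (D i).1)ᵀ * design f fun i => (D i).1)⁻¹ l l)
      ∂(Measure.pi fun _ : Fin n => P₀) ≤ ENNReal.ofReal (K.toReal / n) := by
    have h1 : ENNReal.ofReal (K.toReal / n) = K / n := by
      rw [ENNReal.ofReal_div_of_pos (by exact_mod_cast (by omega : 0 < n)),
        ENNReal.ofReal_toReal hK, ENNReal.ofReal_natCast]
    rw [h1, ← lintegral_map (f := fun B => ENNReal.ofReal (((design f B)ᵀ * design f B)⁻¹ l l))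
      (measurable_gram_inv (fun i k => measurable_design f i k) l l).ennreal_ofReal hfm, hmap]
    exact (lintegral_mono fun D => ofReal_gram_inv_le _ l).trans (hle n hn)
  have h := ols_unbiased hR hη hind hlaw θ hdet l (C := K.toReal / n) (by positivity) hC
  simp_rw [hy, mul_div_assoc]
  exact h

/-- The mean square error of the coefficients of the regression of `y` on `X` is `O(1/n)`. -/
theorem exists_betaHat_moments {p : ℕ} {P₀ : Measure (Obs p)} [IsProbabilityMeasure P₀]
    {μ : EuclideanSpace ℝ (Fin p)} {S : Matrix (Fin p) (Fin p) ℝ} (hS : S.PosDef)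
    (hX : P₀.map Prod.fst = multivariateGaussian μ S) {β : Fin p → ℝ} {σ : ℝ≥0}
    (hLM : LinearModel P₀ β σ) (k : Fin p) :
    ∃ C : ℝ, 0 ≤ C ∧ ∀ n : ℕ, 2 * p + 6 ≤ n →
      MemLp (fun D : Fin n → Obs p => betaHat D k - β k) 2 (Measure.pi fun _ : Fin n => P₀) ∧
      ∫ D : Fin n → Obs p, (betaHat D k - β k) ^ 2 ∂(Measure.pi fun _ : Fin n => P₀) ≤ C / n := by
  obtain ⟨C, hC0, hC⟩ := exists_design_ols_moments hS hX (f := (some : Fin p → Option (Fin p)))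
    (Option.some_injective _) (η := fun z => z.2 - ∑ l, z.1 l * β l) (by fun_prop) hLM.1
    (by
      have := hLM.2.symm.comp (φ := fun x : EuclideanSpace ℝ (Fin p) => fun k => x k) (ψ := id)
        (by fun_prop) measurable_id
      exact this) β (y := Prod.snd) (fun z => by simp) (l := k) rfl
  refine ⟨C, hC0, fun n hn => ?_⟩
  have h := hC n (by simpa using hn)
  exact ⟨h.1, h.2.2⟩

/-- The fitted conditional mean is affine, with slopes that are unbiased and have a mean square
error of order `1/n`. -/
theorem exists_nuHat_moments {p : ℕ} (j : Fin p) {P₀ : Measure (Obs p)} [IsProbabilityMeasure P₀]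
    {μ : EuclideanSpace ℝ (Fin p)} {S : Matrix (Fin p) (Fin p) ℝ} (hS : S.PosDef)
    (hX : P₀.map Prod.fst = multivariateGaussian μ S)
    {c : ℝ} {γ : {k : Fin p // k ≠ j} → ℝ} {v : ℝ≥0} (hc : μ = 0 → c = 0)
    (hlaw : P₀.map (fun z => z.1 j - c - ∑ k, γ k * drop j z.1 k) = gaussianReal 0 v)
    (hind : IndepFun (fun z : Obs p => drop j z.1)
      (fun z => z.1 j - c - ∑ k, γ k * drop j z.1 k) P₀)
    (nuHat : (n : ℕ) → (Fin n → Obs p) → ({l : Fin p // l ≠ j} → ℝ) → ℝ)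
    (hnu : nuHat = nuHatAffine j ∨ (μ = 0 ∧ nuHat = nuHatLinear j)) :
    ∃ (g₀ : (n : ℕ) → (Fin n → Obs p) → ℝ)
      (g : (n : ℕ) → (Fin n → Obs p) → {l : Fin p // l ≠ j} → ℝ),
      (∀ n, Measurable (g₀ n)) ∧ (∀ n, Measurable (g n)) ∧
      (∀ n D z, nuHat n D z = g₀ n D + ∑ l, z l * g n D l) ∧
      ∀ l, ∃ C : ℝ, 0 ≤ C ∧ ∀ n : ℕ, 2 * p + 8 ≤ n →
        MemLp (fun D : Fin n → Obs p => g n D l - γ l) 2 (Measure.pi fun _ : Fin n => P₀) ∧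
        ∫ D : Fin n → Obs p, (g n D l - γ l) ∂(Measure.pi fun _ : Fin n => P₀) = 0 ∧
        ∫ D : Fin n → Obs p, (g n D l - γ l) ^ 2 ∂(Measure.pi fun _ : Fin n => P₀) ≤ C / n := by
  have hcard : Fintype.card {k : Fin p // k ≠ j} ≤ p := by
    simp
  have hη : Measurable fun z : Obs p => z.1 j - c - ∑ k, γ k * drop j z.1 k := by
    have := measurable_drop j
    fun_prop
  rcases hnu with rfl | ⟨hμ, rfl⟩
  · let f : Option {k : Fin p // k ≠ j} → Option (Fin p) := Option.map Subtype.val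
    have hf : Function.Injective f := Option.map_injective Subtype.val_injective
    have hdes : ∀ n (D : Fin n → Obs p),
        (Matrix.of fun i (o : Option {k : Fin p // k ≠ j}) => o.elim 1 (drop j (D i).1))
          = design f fun i => (D i).1 := fun n D => by
      ext i o
      rcases o with _ | k <;> rfl
    have hm : ∀ n o, Measurable fun D : Fin n → Obs p =>
        ols (design f fun i => (D i).1) (fun i => (D i).1 j) o := fun n o =>
      measurable_ols (fun i k => (measurable_design f i k).comp (by fun_prop)) (by fun_prop) o
    refine ⟨fun n D => ols (design f fun i => (D i).1) (fun i => (D i).1 j) none,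
      fun n D l => ols (design f fun i => (D i).1) (fun i => (D i).1 j) (some l),
      fun n => hm n none, fun n => measurable_pi_lambda _ fun l => hm n (some l),
      fun n D z => ?_, fun l => ?_⟩
    · simp only [nuHatAffine, hdes]
    · obtain ⟨C, hC0, hC⟩ := exists_design_ols_moments hS hX hf hη hlaw
        (by
          have := hind.comp (φ := fun (u : {k : Fin p // k ≠ j} → ℝ)
            (o : Option {k : Fin p // k ≠ j}) => o.elim 1 u) (ψ := id)
            (measurable_pi_lambda _ fun o => by
              rcases o with _ | k
              · exact measurable_const
              · exact measurable_pi_apply k) measurable_id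
          convert this using 1
          · funext z o
            rcases o with _ | k <;> rfl
          · rfl)
        (fun o => o.elim c γ) (y := fun z => z.1 j)
        (fun z => by
          rw [Fintype.sum_option]
          simp [f, drop, mul_comm])
        (l := some l) (t := l) rfl
      -- With the intercept there are at most `p + 1` regressors, whence `2 * (p + 1) + 6 = 2 * p +
      -- 8`.
      exact ⟨C, hC0, fun n hn => hC n (by rw [Fintype.card_option]; omega)⟩
  · let f : {k : Fin p // k ≠ j} → Option (Fin p) := fun k => some k
    have hf : Function.Injective f := fun a b h => Subtype.ext (Option.some_injective _ h)
    have hm : ∀ n o, Measurable fun D : Fin n → Obs p =>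
        ols (design f fun i => (D i).1) (fun i => (D i).1 j) o := fun n o =>
      measurable_ols (fun i k => (measurable_design f i k).comp (by fun_prop)) (by fun_prop) o
    refine ⟨fun _ _ => 0,
      fun n D l => ols (design f fun i => (D i).1) (fun i => (D i).1 j) l,
      fun n => measurable_const, fun n => measurable_pi_lambda _ fun l => hm n l,
      fun n D z => ?_, fun l => ?_⟩
    · rw [zero_add]
      rfl
    -- Without an intercept the linear model for `X^j` is correct because `μ = 0` forces `c = 0`.
    · obtain ⟨C, hC0, hC⟩ := exists_design_ols_moments hS hX hf hη hlaw hind γ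
        (y := fun z => z.1 j) (fun z => by simp [f, drop, mul_comm, hc hμ]) (l := l) (t := l) rfl
      exact ⟨C, hC0, fun n hn => hC n (by omega)⟩

/-! ### The conditional null hypothesis kills the `j`-th coefficient -/

/-- Conditional expectations of products of conditionally independent variables factor. -/
theorem condExp_mul_of_condIndepFun {Ω : Type*} {m : MeasurableSpace Ω} [mΩ : MeasurableSpace Ω]
    [StandardBorelSpace Ω] {P : Measure Ω} [IsProbabilityMeasure P] (hm : m ≤ mΩ) {f g : Ω → ℝ}
    (hf : Measurable f) (hg : Measurable g) (hfi : Integrable f P) (hgi : Integrable g P)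
    (hfg : Integrable (fun ω => f ω * g ω) P) (h : CondIndepFun m hm f g P) :
    P[fun ω => f ω * g ω | m] =ᵐ[P] fun ω => P[f | m] ω * P[g | m] ω := by
  -- Under almost every conditional law `f` and `g` are independent in the ordinary sense.
  have h1 := (condIndepFun_iff_map_prod_eq_prod_map_map hf hg).1 h
  filter_upwards [ae_of_ae_trim hm h1, condExp_ae_eq_integral_condExpKernel hm hfg,
    condExp_ae_eq_integral_condExpKernel hm hfi, condExp_ae_eq_integral_condExpKernel hm hgi]
    with ω hω h2 h3 h4
  rw [h2, h3, h4]
  rw [Kernel.map_apply _ (hf.prodMk hg), Kernel.prod_apply, Kernel.map_apply _ hf,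
    Kernel.map_apply _ hg] at hω
  have hi : IndepFun f g (condExpKernel P m ω) :=
    (indepFun_iff_map_prod_eq_prod_map_map hf.aemeasurable hg.aemeasurable).2 hω
  exact hi.integral_fun_mul_eq_mul_integral hf.aestronglyMeasurable hg.aestronglyMeasurable

/-- If `x` and `y` are conditionally independent given `m`, then the part of `x` which is centered
and independent of `m` is uncorrelated with `y`. -/
theorem integral_sub_mul_eq_zero_of_condIndepFun {Ω : Type*} {m : MeasurableSpace Ω}
    [mΩ : MeasurableSpace Ω] [StandardBorelSpace Ω] {P : Measure Ω} [IsProbabilityMeasure P]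
    (hm : m ≤ mΩ) {x y ν ρ : Ω → ℝ} (hx : Measurable x) (hy : Measurable y) (hρm : Measurable ρ)
    (hx2 : MemLp x 2 P) (hy2 : MemLp y 2 P) (hν2 : MemLp ν 2 P) (hρ2 : MemLp ρ 2 P)
    (hνm : StronglyMeasurable[m] ν) (hxρ : x = ρ + ν)
    (hind : Indep (MeasurableSpace.comap ρ inferInstance) m P) (h0 : ∫ ω, ρ ω ∂P = 0)
    (h : CondIndepFun m hm x y P) : ∫ ω, ρ ω * y ω ∂P = 0 := by
  have hcρ : P[ρ | m] =ᵐ[P] fun _ => 0 := by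
    have h1 := condExp_indep_eq (μ := P) (f := ρ) hρm.comap_le hm
      (comap_measurable ρ).stronglyMeasurable hind
    rw [h0] at h1
    exact h1
  have hcx : P[x | m] =ᵐ[P] ν := by
    rw [hxρ]
    have h1 := condExp_add (hρ2.integrable (by norm_num)) (hν2.integrable (by norm_num)) m
    rw [condExp_of_stronglyMeasurable hm hνm (hν2.integrable (by norm_num))] at h1
    filter_upwards [h1, hcρ] with z h2 h3
    rw [h2, Pi.add_apply, h3, zero_add]
  have hfac := condExp_mul_of_condIndepFun hm hx hy (hx2.integrable (by norm_num))
    (hy2.integrable (by norm_num)) (hx2.integrable_mul hy2) h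
  have hpull := condExp_mul_of_stronglyMeasurable_left (m := m) (μ := P) hνm
    (hν2.integrable_mul hy2) (hy2.integrable (by norm_num))
  -- Given `m`, `E[x y] = E[x] E[y] = ν E[y] = E[ν y]`, since `E[x | m] = ν`.
  have h1 : ∫ ω, x ω * y ω ∂P = ∫ ω, ν ω * y ω ∂P := by
    rw [← integral_condExp hm, ← integral_condExp (f := fun ω => ν ω * y ω) hm]
    refine integral_congr_ae ?_
    filter_upwards [hfac, hcx, hpull] with z h2 h3 h4
    have h5 : P[fun ω => ν ω * y ω | m] z = ν z * P[y | m] z := h4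
    rw [h2, h3, h5]
  have h2 : ∀ ω, ρ ω * y ω = x ω * y ω - ν ω * y ω := fun ω => by
    rw [hxρ, Pi.add_apply]
    ring
  simp_rw [h2]
  rw [integral_sub (f := fun ω => x ω * y ω) (g := fun ω => ν ω * y ω)
    (hx2.integrable_mul hy2) (hν2.integrable_mul hy2), h1, sub_self]

/-- Under the conditional null hypothesis the `j`-th coefficient vanishes. -/
theorem coeff_eq_zero_of_conditionalNull {p : ℕ} (j : Fin p) {P₀ : Measure (Obs p)}
    [IsProbabilityMeasure P₀] {β : Fin p → ℝ} (hnull : ConditionalNull P₀ j)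
    (hx : ∀ k, MemLp (fun z : Obs p => z.1 k) 2 P₀)
    (hε : MemLp (fun z : Obs p => z.2 - ∑ l, z.1 l * β l) 2 P₀)
    {c : ℝ} {γ : {k : Fin p // k ≠ j} → ℝ}
    (hind : IndepFun (fun z : Obs p => drop j z.1)
      (fun z => z.1 j - c - ∑ k, γ k * drop j z.1 k) P₀)
    (h0 : ∫ z : Obs p, (z.1 j - c - ∑ k, γ k * drop j z.1 k) ∂P₀ = 0)
    (hρx : ∀ m, ∫ z : Obs p, (z.1 j - c - ∑ k, γ k * drop j z.1 k) * z.1 m ∂P₀ = 0 ↔ m ≠ j)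
    (hρε : ∫ z : Obs p, (z.1 j - c - ∑ k, γ k * drop j z.1 k)
      * (z.2 - ∑ l, z.1 l * β l) ∂P₀ = 0) : β j = 0 := by
  set ρ : Obs p → ℝ := fun z => z.1 j - c - ∑ k, γ k * drop j z.1 k with hρ
  set ν : Obs p → ℝ := fun z => c + ∑ k, γ k * drop j z.1 k with hν
  set ε : Obs p → ℝ := fun z => z.2 - ∑ l, z.1 l * β l with hεd
  have hdm : Measurable fun z : Obs p => drop j z.1 := (measurable_drop j).comp measurable_fst
  have hν2 : MemLp ν 2 P₀ :=
    (memLp_const c).add (memLp_finsetSum _ fun k _ => (hx k).const_mul _)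
  have hρ2 : MemLp ρ 2 P₀ :=
    ((hx j).sub (memLp_const c)).sub (memLp_finsetSum _ fun k _ => (hx k).const_mul _)
  have hy2 : MemLp (fun z : Obs p => z.2) 2 P₀ := by
    have h1 : (fun z : Obs p => z.2) = fun z => ε z + ∑ l, z.1 l * β l := by
      funext z
      simp [hεd]
    rw [h1]
    exact hε.add (memLp_finsetSum _ fun l _ => (hx l).mul_const _)
  have hρm : Measurable ρ := by
    have := measurable_drop j
    fun_prop
  have hνm : StronglyMeasurable[MeasurableSpace.comap (fun z : Obs p => drop j z.1)
      inferInstance] ν := by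
    have h1 : Measurable fun u : {k : Fin p // k ≠ j} → ℝ => c + ∑ k, γ k * u k := by fun_prop
    exact (h1.comp (comap_measurable _)).stronglyMeasurable
  have hxj : (fun z : Obs p => z.1 j) = ρ + ν := by
    funext z
    simp only [hρ, hν, Pi.add_apply]
    ring
  have hzero : ∫ z : Obs p, ρ z * z.2 ∂P₀ = 0 :=
    integral_sub_mul_eq_zero_of_condIndepFun hdm.comap_le (by fun_prop) measurable_snd hρm
      (hx j) hy2 hν2 hρ2 hνm hxj ((IndepFun_iff_Indep _ _ _).1 hind.symm) h0 hnull
  -- `ρ` is orthogonal to the noise and to every covariate but the `j`-th, so one term of the linear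
  -- model survives. Its factor `E[ρ x_j]` is nonzero by `hρx` at `j`.
  have hexp : ∫ z : Obs p, ρ z * z.2 ∂P₀
      = (∫ z : Obs p, ρ z * z.1 j ∂P₀) * β j := by
    have h2 : ∀ z : Obs p, ρ z * z.2 = ρ z * ε z + ∑ l, ρ z * z.1 l * β l := fun z => by
      simp only [mul_assoc, ← Finset.mul_sum, hεd]
      ring
    have hi1 : Integrable (fun z => ρ z * ε z) P₀ := hρ2.integrable_mul hε
    have hi2 : ∀ l, Integrable (fun z : Obs p => ρ z * z.1 l * β l) P₀ := fun l =>
      (hρ2.integrable_mul (hx l)).mul_const _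
    simp_rw [h2]
    rw [integral_add hi1 (integrable_finsetSum _ fun l _ => hi2 l), hρε, zero_add,
      integral_finsetSum _ fun l _ => hi2 l]
    simp_rw [integral_mul_const]
    exact Finset.sum_eq_single j (fun l _ hl => by rw [(hρx l).2 hl, zero_mul]) (by simp)
  rw [hzero] at hexp
  exact (mul_eq_zero.1 hexp.symm).resolve_left fun h => (hρx j).1 h rfl

/-! ### The mean of one loss increment -/

/-- `f` is integrable with mean `c`. -/
def HasMean {Ω : Type*} [MeasurableSpace Ω] (P : Measure Ω) (f : Ω → ℝ) (c : ℝ) : Prop :=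
  Integrable f P ∧ ∫ ω, f ω ∂P = c

namespace HasMean

variable {Ω : Type*} [MeasurableSpace Ω] {P : Measure Ω} {f g : Ω → ℝ} {a b : ℝ}

theorem add (hf : HasMean P f a) (hg : HasMean P g b) :
    HasMean P (fun ω => f ω + g ω) (a + b) :=
  ⟨hf.1.add hg.1, by rw [integral_add hf.1 hg.1, hf.2, hg.2]⟩

theorem sub (hf : HasMean P f a) (hg : HasMean P g b) :
    HasMean P (fun ω => f ω - g ω) (a - b) :=
  ⟨hf.1.sub hg.1, by rw [integral_sub hf.1 hg.1, hf.2, hg.2]⟩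

theorem const_mul (c : ℝ) (hf : HasMean P f a) : HasMean P (fun ω => c * f ω) (c * a) :=
  ⟨hf.1.const_mul c, by rw [integral_const_mul, hf.2]⟩

theorem sum {ι : Type*} [Fintype ι] {f : ι → Ω → ℝ} {a : ι → ℝ}
    (hf : ∀ i, HasMean P (f i) (a i)) : HasMean P (fun ω => ∑ i, f i ω) (∑ i, a i) :=
  ⟨integrable_finsetSum _ fun i _ => (hf i).1, by
    rw [integral_finsetSum _ fun i _ => (hf i).1]
    exact Finset.sum_congr rfl fun i _ => (hf i).2⟩

theorem congr (hf : HasMean P f a) (hfg : ∀ ω, f ω = g ω) (hab : a = b) : HasMean P g b := by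
  obtain rfl : f = g := funext hfg
  exact hab ▸ hf

theorem mul_of_indepFun (hf : HasMean P f a) (hg : HasMean P g b) (h : IndepFun f g P) :
    HasMean P (fun ω => f ω * g ω) (a * b) :=
  ⟨h.integrable_mul hf.1 hg.1, by
    rw [h.integral_fun_mul_eq_mul_integral hf.1.aestronglyMeasurable hg.1.aestronglyMeasurable,
      hf.2, hg.2]⟩

theorem of_integrable (hf : Integrable f P) : HasMean P f (∫ ω, f ω ∂P) := ⟨hf, rfl⟩

/-- The mean of the product of three independent quantities. -/
theorem mul_mul_of_indepFun [IsProbabilityMeasure P] {𝓐 𝓑 𝓣 : Type*} [MeasurableSpace 𝓐]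
    [MeasurableSpace 𝓑] [MeasurableSpace 𝓣] {e : Ω → 𝓐} {u : Ω → 𝓑} {T : Ω → 𝓣}
    (hT : IndepFun (fun ω => (e ω, u ω)) T P) (heu : IndepFun e u P)
    {φ : 𝓐 → ℝ} {ψ : 𝓑 → ℝ} {τ : 𝓣 → ℝ} (hφ : Measurable φ) (hψ : Measurable ψ)
    (hτ : Measurable τ) {c : ℝ} (h1 : HasMean P (fun ω => φ (e ω)) a)
    (h2 : HasMean P (fun ω => ψ (u ω)) b) (h3 : HasMean P (fun ω => τ (T ω)) c) :
    HasMean P (fun ω => φ (e ω) * ψ (u ω) * τ (T ω)) (a * b * c) := by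
  have hi1 : IndepFun (fun ω => φ (e ω)) (fun ω => ψ (u ω)) P := heu.comp hφ hψ
  have hi2 : IndepFun (fun ω => φ (e ω) * ψ (u ω)) (fun ω => τ (T ω)) P :=
    hT.comp (φ := fun q : 𝓐 × 𝓑 => φ q.1 * ψ q.2) (by fun_prop) hτ
  exact (h1.mul_of_indepFun h2 hi1).mul_of_indepFun h3 hi2

end HasMean

/-- The mean of the loss increment `e_j δ (e_j δ + 2 (x e - ε))`, where
`δ = Δρ - u Δx` is the change of the `j`-th coordinate. -/
theorem hasMean_loss_increment {Ω 𝓣 : Type*} [MeasurableSpace Ω] [MeasurableSpace 𝓣]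
    {P : Measure Ω} [IsProbabilityMeasure P] {p : ℕ} (j : Fin p) {κ : Type*} [Fintype κ]
    {e : Ω → Fin p → ℝ} {u : Ω → κ → ℝ} {T : Ω → 𝓣}
    (hT : IndepFun (fun ω => (e ω, u ω)) T P) (heu : IndepFun e u P)
    (he : ∀ k, MemLp (fun ω => e ω k) 2 P) (hu : ∀ l, MemLp (fun ω => u ω l) 2 P)
    (hu0 : ∀ l, ∫ ω, u ω l ∂P = 0)
    {dρ ε : 𝓣 → ℝ} {dx : κ → 𝓣 → ℝ} {x : Fin p → 𝓣 → ℝ}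
    (mρ : Measurable dρ) (mε : Measurable ε) (mdx : ∀ l, Measurable (dx l))
    (mx : ∀ k, Measurable (x k)) (τ : ℝ) (M : κ → κ → ℝ)
    (hρρ : HasMean P (fun ω => dρ (T ω) * dρ (T ω)) (2 * τ))
    (hρx : ∀ k, HasMean P (fun ω => dρ (T ω) * x k (T ω)) (if k = j then -τ else 0))
    (hρε : HasMean P (fun ω => dρ (T ω) * ε (T ω)) 0)
    (hρdx : ∀ l, Integrable (fun ω => dρ (T ω) * dx l (T ω)) P)
    (hdxdx : ∀ l l', HasMean P (fun ω => dx l (T ω) * dx l' (T ω)) (M l l'))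
    (hdxx : ∀ l k, Integrable (fun ω => dx l (T ω) * x k (T ω)) P)
    (hdxε : ∀ l, Integrable (fun ω => dx l (T ω) * ε (T ω)) P) :
    HasMean P (fun ω => e ω j * (dρ (T ω) - ∑ l, u ω l * dx l (T ω)) *
        (e ω j * (dρ (T ω) - ∑ l, u ω l * dx l (T ω))
          + 2 * (∑ k, x k (T ω) * e ω k - ε (T ω))))
      ((∫ ω, e ω j ^ 2 ∂P) * ∑ l, ∑ l', (∫ ω, u ω l * u ω l' ∂P) * M l l') := by
  have hee : ∀ k, HasMean P (fun ω => e ω j * e ω k) (∫ ω, e ω j * e ω k ∂P) := fun k =>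
    .of_integrable ((he j).integrable_mul (he k))
  have he1 : HasMean P (fun ω => e ω j) (∫ ω, e ω j ∂P) :=
    .of_integrable ((he j).integrable (by norm_num))
  have h1u : HasMean P (fun _ => (1 : ℝ)) 1 := ⟨integrable_const _, by simp⟩
  have huu : ∀ l l', HasMean P (fun ω => u ω l * u ω l') (∫ ω, u ω l * u ω l' ∂P) := fun l l' =>
    .of_integrable ((hu l).integrable_mul (hu l'))
  have hu1 : ∀ l, HasMean P (fun ω => u ω l) 0 := fun l =>
    ⟨(hu l).integrable (by norm_num), hu0 l⟩
  -- Expansion into products of a function of `e`, one of `u` and one of the test pair. `t2`, `t5`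
  -- and `t7` are linear in the centered `u`, and `t6` contains `E[Δρ ε] = 0`. `t1` contributes `2τ
  -- E[e_j²]` and twice the sum of `t4` contributes `-2τ E[e_j²]`. Only `t3` remains.
  have t1 := HasMean.mul_mul_of_indepFun (φ := fun a => a j * a j) (ψ := fun _ => 1)
    (τ := fun t => dρ t * dρ t) hT heu (by fun_prop) (by fun_prop) (by fun_prop) (hee j) h1u hρρ
  have t2 := fun l => HasMean.mul_mul_of_indepFun (φ := fun a => a j * a j) (ψ := fun b => b l)
    (τ := fun t => dρ t * dx l t) hT heu (by fun_prop) (by fun_prop) (by fun_prop) (hee j) (hu1 l)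
    (.of_integrable (hρdx l))
  have t3 := fun l l' => HasMean.mul_mul_of_indepFun (φ := fun a => a j * a j)
    (ψ := fun b => b l * b l') (τ := fun t => dx l t * dx l' t) hT heu (by fun_prop)
    (by fun_prop) (by fun_prop) (hee j) (huu l l') (hdxdx l l')
  have t4 := fun k => HasMean.mul_mul_of_indepFun (φ := fun a => a j * a k) (ψ := fun _ => 1)
    (τ := fun t => dρ t * x k t) hT heu (by fun_prop) (by fun_prop) (by fun_prop) (hee k) h1u
    (hρx k)
  have t5 := fun k l => HasMean.mul_mul_of_indepFun (φ := fun a => a j * a k) (ψ := fun b => b l)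
    (τ := fun t => dx l t * x k t) hT heu (by fun_prop) (by fun_prop) (by fun_prop) (hee k)
    (hu1 l) (.of_integrable (hdxx l k))
  have t6 := HasMean.mul_mul_of_indepFun (φ := fun a => a j) (ψ := fun _ => 1)
    (τ := fun t => dρ t * ε t) hT heu (by fun_prop) (by fun_prop) (by fun_prop) he1 h1u hρε
  have t7 := fun l => HasMean.mul_mul_of_indepFun (φ := fun a => a j) (ψ := fun b => b l)
    (τ := fun t => dx l t * ε t) hT heu (by fun_prop) (by fun_prop) (by fun_prop) he1
    (hu1 l) (.of_integrable (hdxε l))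
  have s := ((((((t1.sub ((HasMean.sum t2).const_mul 2)).add
    (HasMean.sum fun l => HasMean.sum (t3 l))).add ((HasMean.sum t4).const_mul 2)).sub
    ((HasMean.sum fun k => HasMean.sum (t5 k)).const_mul 2)).sub (t6.const_mul 2)).add
    ((HasMean.sum t7).const_mul 2))
  refine s.congr (fun ω => ?_) ?_
  · have r2 : ∑ l, e ω j * e ω j * u ω l * (dρ (T ω) * dx l (T ω))
        = e ω j * e ω j * dρ (T ω) * ∑ l, u ω l * dx l (T ω) := by
      rw [Finset.mul_sum]
      exact Finset.sum_congr rfl fun l _ => by ring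
    have r3 : ∑ l, ∑ l', e ω j * e ω j * (u ω l * u ω l') * (dx l (T ω) * dx l' (T ω))
        = e ω j * e ω j * ((∑ l, u ω l * dx l (T ω)) * ∑ l, u ω l * dx l (T ω)) := by
      rw [Finset.sum_mul_sum, Finset.mul_sum]
      refine Finset.sum_congr rfl fun l _ => ?_
      rw [Finset.mul_sum]
      exact Finset.sum_congr rfl fun l _ => by ring
    have r4 : ∑ k, e ω j * e ω k * 1 * (dρ (T ω) * x k (T ω))
        = e ω j * dρ (T ω) * ∑ k, x k (T ω) * e ω k := by
      rw [Finset.mul_sum]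
      exact Finset.sum_congr rfl fun l _ => by ring
    have r5 : ∑ k, ∑ l, e ω j * e ω k * u ω l * (dx l (T ω) * x k (T ω))
        = e ω j * ((∑ k, x k (T ω) * e ω k) * ∑ l, u ω l * dx l (T ω)) := by
      rw [Finset.sum_mul_sum, Finset.mul_sum]
      refine Finset.sum_congr rfl fun l _ => ?_
      rw [Finset.mul_sum]
      exact Finset.sum_congr rfl fun l _ => by ring
    have r7 : ∑ l, e ω j * u ω l * (dx l (T ω) * ε (T ω))
        = e ω j * ε (T ω) * ∑ l, u ω l * dx l (T ω) := by
      rw [Finset.mul_sum]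
      exact Finset.sum_congr rfl fun l _ => by ring
    rw [r2, r3, r4, r5, r7]
    ring
  · simp only [mul_zero, zero_mul, Finset.sum_const_zero, mul_one, mul_ite, Finset.sum_ite_eq',
      Finset.mem_univ, if_true, add_zero, sub_zero]
    simp only [mul_assoc, ← Finset.mul_sum, sq]
    ring

theorem MeasurePreserving.hasMean {Ω E : Type*} [MeasurableSpace Ω] [MeasurableSpace E]
    {P : Measure Ω} {Q : Measure E} {Z : Ω → E} (hZ : MeasurePreserving Z P Q) {f : E → ℝ} {c : ℝ}
    (hf : HasMean Q f c) : HasMean P (fun ω => f (Z ω)) c := by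
  refine ⟨hZ.integrable_comp_of_integrable hf.1, ?_⟩
  rw [← hf.2, ← hZ.map_eq, integral_map hZ.measurable.aemeasurable]
  rw [hZ.map_eq]
  exact hf.1.aestronglyMeasurable

/-- Mixed moments of two independent copies. -/
theorem hasMean_sub_mul {Ω E : Type*} [MeasurableSpace Ω] [MeasurableSpace E]
    {P : Measure Ω} {Q : Measure E} [IsProbabilityMeasure Q] {Z Z' : Ω → E}
    (hZ : MeasurePreserving Z P Q) (hZ' : MeasurePreserving Z' P Q) (hI : IndepFun Z Z' P)
    {a b : E → ℝ} (ha : Measurable a) (hb : Measurable b) (ha2 : MemLp a 2 Q)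
    (hb2 : MemLp b 2 Q) :
    HasMean P (fun ω => (a (Z' ω) - a (Z ω)) * b (Z ω))
        ((∫ z, a z ∂Q) * (∫ z, b z ∂Q) - ∫ z, a z * b z ∂Q) ∧
      HasMean P (fun ω => (a (Z' ω) - a (Z ω)) * (b (Z' ω) - b (Z ω)))
        (2 * (∫ z, a z * b z ∂Q - (∫ z, a z ∂Q) * ∫ z, b z ∂Q)) := by
  have hab : HasMean Q (fun z => a z * b z) (∫ z, a z * b z ∂Q) :=
    .of_integrable (ha2.integrable_mul hb2)
  have h11 := MeasurePreserving.hasMean hZ hab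
  have h22 := MeasurePreserving.hasMean hZ' hab
  have ha1 : HasMean Q a (∫ z, a z ∂Q) := .of_integrable (ha2.integrable (by norm_num))
  have hb1 : HasMean Q b (∫ z, b z ∂Q) := .of_integrable (hb2.integrable (by norm_num))
  have h21 := (MeasurePreserving.hasMean hZ' ha1).mul_of_indepFun (MeasurePreserving.hasMean hZ hb1)
    (hI.symm.comp ha hb)
  have h12 := (MeasurePreserving.hasMean hZ ha1).mul_of_indepFun (MeasurePreserving.hasMean hZ' hb1)
    (hI.comp ha hb)
  exact ⟨(h21.sub h11).congr (fun ω => by ring) rfl,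
    (((h22.sub h21).sub h12).add h11).congr (fun ω => by ring) (by ring)⟩

/-- The loss increment of a permuted observation, through the errors of the two regressions. -/
theorem loss_increment_eq {p : ℕ} {j : Fin p} {β : Fin p → ℝ} (hβ : β j = 0) {n : ℕ}
    (D : Fin n → Obs p) {ν : ({l : Fin p // l ≠ j} → ℝ) → ℝ} {g₀ c : ℝ}
    {g γ : {l : Fin p // l ≠ j} → ℝ} (hν : ∀ z, ν z = g₀ + ∑ l, z l * g l)
    (x x' : EuclideanSpace ℝ (Fin p)) (y : ℝ) :
    quadLoss (mHat D (condSample j ν x x')) y - quadLoss (mHat D x) y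
      = (betaHat D j - β j) *
        (((x' j - c - ∑ l, γ l * drop j x' l) - (x j - c - ∑ l, γ l * drop j x l))
          - ∑ l, (g l - γ l) * (drop j x' l - drop j x l)) *
        ((betaHat D j - β j) *
          (((x' j - c - ∑ l, γ l * drop j x' l) - (x j - c - ∑ l, γ l * drop j x l))
            - ∑ l, (g l - γ l) * (drop j x' l - drop j x l))
          + 2 * (∑ k, x k * (betaHat D k - β k) - (y - ∑ k, x k * β k))) := by
  set δ := ((x' j - c - ∑ l, γ l * drop j x' l) - (x j - c - ∑ l, γ l * drop j x l))
          - ∑ l, (g l - γ l) * (drop j x' l - drop j x l) with hδ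
  -- The intercept `g₀` cancels between the two predictions, so its estimation error plays no role;
  -- `c` cancels likewise.
  have hδ' : ν (drop j x) + (x' j - ν (drop j x')) = x j + δ := by
    have h1 : ∑ l, (g l - γ l) * (drop j x' l - drop j x l)
        = ∑ l, drop j x' l * g l - ∑ l, drop j x l * g l - ∑ l, γ l * drop j x' l
          + ∑ l, γ l * drop j x l := by
      simp only [← Finset.sum_sub_distrib, ← Finset.sum_add_distrib]
      exact Finset.sum_congr rfl fun l _ => by ring
    rw [hδ, hν, hν, h1]
    ring
  have hm : mHat D (condSample j ν x x') = mHat D x + δ * betaHat D j := by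
    have h1 : ∀ l, (condSample j ν x x') l = x l + if l = j then δ else 0 := fun l => by
      simp only [condSample]
      split_ifs with h
      · rw [hδ', h]
      · simp
    simp [mHat, h1, add_mul, Finset.sum_add_distrib]
  have hx : ∑ k, x k * (betaHat D k - β k) - (y - ∑ k, x k * β k) = mHat D x - y := by
    simp only [mHat, mul_sub, Finset.sum_sub_distrib]
    ring
  -- Here `β j = 0` identifies the fitted coefficient with its own error, which makes the increment
  -- small.
  rw [hm, hx, hβ, sub_zero]
  simp only [quadLoss]
  ring

/-! ### Laws and independence of the three samples -/

theorem measurePreserving_sample {p : ℕ} {P₀ : Measure (Obs p)} [IsProbabilityMeasure P₀]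
    {Ω : Type*} [MeasurableSpace Ω] {P : Measure Ω} [IsProbabilityMeasure P]
    {data : Fold → ℕ → Ω → Obs p} (hmeas : ∀ s i, Measurable (data s i))
    (hlaw : ∀ s i, P.map (data s i) = P₀)
    (hindep : iIndepFun (fun k : Fold × ℕ => data k.1 k.2) P) (s : Fold) (n : ℕ) :
    MeasurePreserving (fun ω (i : Fin n) => data s i ω) P (Measure.pi fun _ : Fin n => P₀) := by
  refine ⟨by fun_prop, ?_⟩
  have h1 : iIndepFun (fun i : Fin n => data s i) P :=
    hindep.precomp (g := fun i : Fin n => (s, (i : ℕ))) fun a b h => by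
      simpa [Fin.ext_iff] using h
  have h2 := (iIndepFun_iff_map_fun_eq_pi_map (f := fun i : Fin n => data s i)
    fun i => (hmeas s i).aemeasurable).1 h1
  rw [h2]
  simp_rw [hlaw]

theorem indepFun_train {p : ℕ} {Ω : Type*} [MeasurableSpace Ω] {P : Measure Ω}
    {data : Fold → ℕ → Ω → Obs p} (hmeas : ∀ s i, Measurable (data s i))
    (hindep : iIndepFun (fun k : Fold × ℕ => data k.1 k.2) P) (n : ℕ) :
    IndepFun (fun ω (i : Fin n) => data .trainM i ω) (fun ω (i : Fin n) => data .trainNu i ω) P := by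
  have h := hindep.indepFun_finset ({Fold.trainM} ×ˢ Finset.range n)
    ({Fold.trainNu} ×ˢ Finset.range n)
    (by
      rw [Finset.disjoint_left]
      rintro ⟨s, i⟩ h1 h2
      simp only [Finset.mem_product, Finset.mem_singleton] at h1 h2
      exact absurd (h1.1.symm.trans h2.1) (by simp)) fun k => hmeas k.1 k.2
  exact h.comp
    (φ := fun q (i : Fin n) => q ⟨(.trainM, i), by simp⟩)
    (ψ := fun q (i : Fin n) => q ⟨(.trainNu, i), by simp⟩)
    (measurable_pi_lambda _ fun i => measurable_pi_apply _)
    (measurable_pi_lambda _ fun i => measurable_pi_apply _)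

/-- The training samples are taken jointly: with `indepFun_train` this gives the mutual independence
of `β̂`, `ν̂` and a test pair that factors the means. -/
theorem indepFun_train_test {p : ℕ} {Ω : Type*} [MeasurableSpace Ω] {P : Measure Ω}
    {data : Fold → ℕ → Ω → Obs p} (hmeas : ∀ s i, Measurable (data s i))
    (hindep : iIndepFun (fun k : Fold × ℕ => data k.1 k.2) P) (n i k : ℕ) :
    IndepFun (fun ω => ((fun i : Fin n => data .trainM i ω), fun i : Fin n => data .trainNu i ω))
      (fun ω => (data .test i ω, data .test k ω)) P := by
  classical
  have h := hindep.indepFun_finset ({Fold.trainM, Fold.trainNu} ×ˢ Finset.range n)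
    ({Fold.test} ×ˢ {i, k})
    (by
      rw [Finset.disjoint_left]
      rintro ⟨s, i⟩ h1 h2
      simp only [Finset.mem_product, Finset.mem_singleton, Finset.mem_insert] at h1 h2
      rw [h2.1] at h1
      simp at h1) fun k => hmeas k.1 k.2
  exact h.comp
    (φ := fun q : ↥(({Fold.trainM, Fold.trainNu} : Finset Fold) ×ˢ Finset.range n) → Obs p =>
      ((fun i : Fin n => q ⟨(.trainM, i), by simp⟩), fun i : Fin n => q ⟨(.trainNu, i), by simp⟩))
    (ψ := fun q : ↥(({Fold.test} : Finset Fold) ×ˢ ({i, k} : Finset ℕ)) → Obs p =>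
      (q ⟨(.test, i), by simp⟩, q ⟨(.test, k), by simp⟩))
    (by fun_prop) (by fun_prop)

theorem measurable_betaHat {p n : ℕ} (k : Fin p) :
    Measurable fun D : Fin n → Obs p => betaHat D k := by
  unfold betaHat
  exact measurable_ols
    (A := fun D : Fin n → Obs p => Matrix.of fun i l => (D i).1 l)
    (fun i l => (by fun_prop : Measurable fun D : Fin n → Obs p => (D i).1 l)) (by fun_prop) k

theorem indepFun_comp_of_measurePreserving {Ω E α β : Type*} [MeasurableSpace Ω]
    [MeasurableSpace E] [MeasurableSpace α] [MeasurableSpace β] {P : Measure Ω} {Q : Measure E}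
    [IsProbabilityMeasure P] {Z : Ω → E} (hZ : MeasurePreserving Z P Q) {a : E → α} {b : E → β}
    (ha : Measurable a) (hb : Measurable b) (h : IndepFun a b Q) :
    IndepFun (fun ω => a (Z ω)) (fun ω => b (Z ω)) P := by
  have hZm := hZ.measurable
  have : IsProbabilityMeasure Q := by
    rw [← hZ.map_eq]
    exact Measure.isProbabilityMeasure_map hZm.aemeasurable
  rw [indepFun_iff_map_prod_eq_prod_map_map ha.aemeasurable hb.aemeasurable, ← hZ.map_eq,
    Measure.map_map (by fun_prop) hZm, Measure.map_map ha hZm, Measure.map_map hb hZm] at h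
  exact (indepFun_iff_map_prod_eq_prod_map_map (by fun_prop) (by fun_prop)).2 h

/-- Mean and variance of a variable with law `N(0, v)`. -/
theorem moments_of_map_eq_gaussianReal {Ω : Type*} [MeasurableSpace Ω] {P : Measure Ω}
    {η : Ω → ℝ} (hη : Measurable η) {v : ℝ≥0} (h : P.map η = gaussianReal 0 v) :
    MemLp η 2 P ∧ ∫ ω, η ω ∂P = 0 ∧ ∫ ω, η ω * η ω ∂P = v := by
  have hd : IdentDistrib η id P (gaussianReal 0 v) :=
    ⟨hη.aemeasurable, aemeasurable_id, by rw [h, Measure.map_id]⟩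
  have h2 : MemLp η 2 P := hd.symm.memLp_snd (memLp_id_gaussianReal 2)
  have h0 : ∫ ω, η ω ∂P = 0 := by
    rw [hd.integral_eq]
    simp
  refine ⟨h2, h0, ?_⟩
  have h1 := hd.variance_eq
  rw [variance_id_gaussianReal, variance_of_integral_eq_zero h2.aestronglyMeasurable.aemeasurable
    h0] at h1
  simpa [sq] using h1

/-- Measurability is stated in the whole data array, because a random permutation is assumed
independent of that array. -/
theorem measurable_cpi {p : ℕ} (j : Fin p) {n nt : ℕ}
    {ν : (Fin n → Obs p) → ({l : Fin p // l ≠ j} → ℝ) → ℝ} {g₀ : (Fin n → Obs p) → ℝ}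
    {g : (Fin n → Obs p) → {l : Fin p // l ≠ j} → ℝ} (hg₀ : Measurable g₀) (hg : Measurable g)
    (hν : ∀ D z, ν D z = g₀ D + ∑ l, z l * g D l) (π : Equiv.Perm (Fin nt)) :
    Measurable fun q : Fold → ℕ → Obs p => cpi quadLoss j (mHat fun i : Fin n => q .trainM i)
      (ν fun i : Fin n => q .trainNu i) π (fun i : Fin nt => q .test i) := by
  have hb : ∀ k, Measurable fun q : Fold → ℕ → Obs p => betaHat (fun i : Fin n => q .trainM i) k :=
    fun k => (measurable_betaHat k).comp (by fun_prop)
  have hN : Measurable fun (q : Fold → ℕ → Obs p) (i : Fin n) => q .trainNu i := by fun_prop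
  have hg₀' := hg₀.comp hN
  have hg' := fun l => (measurable_pi_apply l).comp (hg.comp hN)
  have hx : ∀ (i : ℕ) (k : Fin p), Measurable fun q : Fold → ℕ → Obs p => (q .test i).1 k :=
    fun i k => by fun_prop
  have hνm : ∀ i : ℕ, Measurable fun q : Fold → ℕ → Obs p =>
      ν (fun i : Fin n => q .trainNu i) (drop j (q .test i).1) := fun i => by
    simp only [hν]
    exact hg₀'.add (Finset.measurable_fun_sum _ fun l _ => (hx i l).mul (hg' l))
  have hc : ∀ (i k : ℕ) (l : Fin p), Measurable fun q : Fold → ℕ → Obs p =>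
      condSample j (ν fun i : Fin n => q .trainNu i) (q .test i).1 (q .test k).1 l := fun i k l => by
    simp only [condSample]
    split_ifs
    · exact (hνm i).add ((hx k j).sub (hνm k))
    · exact hx i l
  simp only [cpi, quadLoss, mHat]
  refine (Finset.measurable_fun_sum _ fun i _ => ?_).const_mul _
  refine Measurable.sub (Measurable.pow_const (Measurable.sub ?_ (by fun_prop)) 2)
    (Measurable.pow_const (Measurable.sub ?_ (by fun_prop)) 2)
  · exact Finset.measurable_fun_sum _ fun l _ => (hc i (π i) l).mul (hb l)
  · exact Finset.measurable_fun_sum _ fun l _ => (hx i l).mul (hb l)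

/-! ### The CPI estimate for a fixed permutation -/

/-- For a fixed permutation, the CPI estimate is integrable and its mean is `O(1/n²)`. -/
theorem exists_hasMean_cpi_le {p : ℕ} (j : Fin p)
    {P₀ : Measure (Obs p)} [IsProbabilityMeasure P₀]
    {μ : EuclideanSpace ℝ (Fin p)} {S : Matrix (Fin p) (Fin p) ℝ} (hS : S.PosDef)
    (hX : P₀.map Prod.fst = multivariateGaussian μ S)
    {β : Fin p → ℝ} {σ : ℝ≥0} (hLM : LinearModel P₀ β σ) (hnull : ConditionalNull P₀ j)
    {Ω : Type*} [MeasurableSpace Ω] {P : Measure Ω} [IsProbabilityMeasure P]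
    {data : Fold → ℕ → Ω → Obs p} (hmeas : ∀ s i, Measurable (data s i))
    (hlaw : ∀ s i, P.map (data s i) = P₀)
    (hindep : iIndepFun (fun k : Fold × ℕ => data k.1 k.2) P)
    (nuHat : (n : ℕ) → (Fin n → Obs p) → ({l : Fin p // l ≠ j} → ℝ) → ℝ)
    (hnu : nuHat = nuHatAffine j ∨ (μ = 0 ∧ nuHat = nuHatLinear j)) :
    ∃ (C : ℝ) (N : ℕ), ∀ n : ℕ, N ≤ n → ∀ nt : ℕ, 0 < nt → ∀ π : Equiv.Perm (Fin nt),
      (Measurable fun q : Fold → ℕ → Obs p => cpi quadLoss j (mHat fun i : Fin n => q .trainM i)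
        (nuHat n fun i : Fin n => q .trainNu i) π (fun i : Fin nt => q .test i)) ∧
      ∃ b : ℝ, HasMean P (fun ω => cpi quadLoss j (mHat fun i : Fin n => data .trainM i ω)
        (nuHat n fun i : Fin n => data .trainNu i ω) π (fun i : Fin nt => data .test i ω)) b ∧
        |b| ≤ C / (n : ℝ) ^ 2 := by
  obtain ⟨c, γ, v, hv, hc, hρlaw, hρind⟩ := exists_gaussian_regression μ hS j
  have hfst : MeasurePreserving Prod.fst P₀ (multivariateGaussian μ S) := ⟨measurable_fst, hX⟩
  have hdm := measurable_drop j
  set ρ : EuclideanSpace ℝ (Fin p) → ℝ := fun x => x j - c - ∑ k, γ k * drop j x k with hρ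
  have hρm : Measurable ρ := by fun_prop
  have hρlaw' : P₀.map (fun z => ρ z.1) = gaussianReal 0 v := by
    rw [← hρlaw, ← hX, Measure.map_map hρm measurable_fst]
    rfl
  have hρind' : IndepFun (fun z : Obs p => drop j z.1) (fun z => ρ z.1) P₀ :=
    indepFun_comp_of_measurePreserving hfst hdm hρm hρind
  set ε : Obs p → ℝ := fun z => z.2 - ∑ l, z.1 l * β l with hε
  have hεm : Measurable ε := by fun_prop
  obtain ⟨hρ2, hρ0, hρρ⟩ := moments_of_map_eq_gaussianReal (by fun_prop) hρlaw'
  obtain ⟨hε2, hε0, -⟩ := moments_of_map_eq_gaussianReal hεm hLM.1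
  have hx2 : ∀ k, MemLp (fun z : Obs p => z.1 k) 2 P₀ := fun k => by
    have hid : HasGaussianLaw (fun x : EuclideanSpace ℝ (Fin p) => x) (multivariateGaussian μ S) :=
      IsGaussian.hasGaussianLaw_id
    exact (hid.map_fun (EuclideanSpace.proj (𝕜 := ℝ) k)).memLp_two.comp_measurePreserving hfst
  have hρε : ∫ z : Obs p, ρ z.1 * ε z ∂P₀ = 0 := by
    have hI : IndepFun (fun z : Obs p => ρ z.1) ε P₀ :=
      (hLM.2.comp (φ := id) measurable_id hρm).symm
    rw [hI.integral_fun_mul_eq_mul_integral hρ2.aestronglyMeasurable hε2.aestronglyMeasurable,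
      hρ0, zero_mul]
  have hρx' : ∀ k : {k : Fin p // k ≠ j}, ∫ z : Obs p, ρ z.1 * z.1 k ∂P₀ = 0 := fun k => by
    have hI : IndepFun (fun z : Obs p => ρ z.1) (fun z => z.1 k) P₀ :=
      (hρind'.comp (φ := fun q : {k : Fin p // k ≠ j} → ℝ => q k) (ψ := id)
        (by fun_prop) measurable_id).symm
    rw [hI.integral_fun_mul_eq_mul_integral hρ2.aestronglyMeasurable (hx2 k).aestronglyMeasurable,
      hρ0, zero_mul]
  -- Write `x_j = ρ + c + ∑ γ_k x_k`; `ρ` is centered and orthogonal to the other covariates.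
  have hρxj : ∫ z : Obs p, ρ z.1 * z.1 j ∂P₀ = v := by
    have h1 : HasMean P₀ (fun z => ρ z.1 * ρ z.1) v := ⟨hρ2.integrable_mul hρ2, hρρ⟩
    have h2 : HasMean P₀ (fun z => ρ z.1) 0 := ⟨hρ2.integrable (by norm_num), hρ0⟩
    have h3 := fun k : {k : Fin p // k ≠ j} =>
      HasMean.const_mul (γ k) (P := P₀) (f := fun z => ρ z.1 * z.1 k)
        ⟨hρ2.integrable_mul (hx2 k), hρx' k⟩
    refine (((h1.add (h2.const_mul c)).add (HasMean.sum h3)).congr (fun z => ?_)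
      (b := (v : ℝ)) (by simp)).2
    have h4 : ∑ k : {k : Fin p // k ≠ j}, γ k * (ρ z.1 * z.1 k)
        = ρ z.1 * ∑ k : {k : Fin p // k ≠ j}, γ k * drop j z.1 k := by
      rw [Finset.mul_sum]
      exact Finset.sum_congr rfl fun k _ => by simp only [drop]; ring
    rw [h4]
    simp only [hρ]
    ring
  have hρx : ∀ k, ∫ z : Obs p, ρ z.1 * z.1 k ∂P₀ = if k = j then (v : ℝ) else 0 := fun k => by
    split_ifs with h
    · rw [h, hρxj]
    · exact hρx' ⟨k, h⟩
  have hβ : β j = 0 := by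
    refine coeff_eq_zero_of_conditionalNull j hnull hx2 hε2 hρind' hρ0 (fun k => ?_) hρε
    have := hρx k
    simp only [hρ] at this
    rw [this]
    simp [hv]
  choose Cb hCb0 hCb using fun k => exists_betaHat_moments hS hX hLM k
  obtain ⟨g₀, g, hg₀m, hgm, hgν, hgC⟩ := exists_nuHat_moments j hS hX hc hρlaw' hρind' nuHat hnu
  choose Cg hCg0 hCg using hgC
  -- The covariance of the difference of two independent copies: twice that of `X^{-j}`.
  let M : {k : Fin p // k ≠ j} → {k : Fin p // k ≠ j} → ℝ := fun l l' =>
    2 * (∫ z : Obs p, drop j z.1 l * drop j z.1 l' ∂P₀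
      - (∫ z : Obs p, drop j z.1 l ∂P₀) * ∫ z : Obs p, drop j z.1 l' ∂P₀)
  -- `Cb j` bounds `n E[e_j²]`; the half sums bound `n |E[u_l u_l']|` through `|u_l u_l'| ≤ (u_l² +
  -- u_l'²) / 2`. Nothing here depends on the test sample or on `π`.
  set C : ℝ := Cb j * ∑ l, ∑ l', (Cg l + Cg l') / 2 * |M l l'| with hC
  have hCnn : 0 ≤ C := mul_nonneg (hCb0 j) (Finset.sum_nonneg fun l _ => Finset.sum_nonneg fun l' _ =>
    mul_nonneg (by linarith [hCg0 l, hCg0 l']) (abs_nonneg _))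
  refine ⟨C, 2 * p + 8, fun n hn nt hnt π => ?_⟩
  have hn0 : (0 : ℝ) < n := by exact_mod_cast (by omega : 0 < n)
  have hDM := measurePreserving_sample hmeas hlaw hindep .trainM n
  have hDN := measurePreserving_sample hmeas hlaw hindep .trainNu n
  have hT1 : ∀ i, MeasurePreserving (data .test i) P P₀ := fun i => ⟨hmeas _ i, hlaw _ i⟩
  set e : Ω → Fin p → ℝ := fun ω k => betaHat (fun i : Fin n => data .trainM i ω) k - β k with he
  set u : Ω → {k : Fin p // k ≠ j} → ℝ := fun ω l =>
    g n (fun i : Fin n => data .trainNu i ω) l - γ l with hu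
  have hφm : Measurable fun (D : Fin n → Obs p) k => betaHat D k - β k :=
    measurable_pi_lambda _ fun k => (measurable_betaHat k).sub_const _
  have hψm : Measurable fun (D : Fin n → Obs p) l => g n D l - γ l :=
    measurable_pi_lambda _ fun l => ((measurable_pi_apply l).comp (hgm n)).sub_const _
  have heu : IndepFun e u P := (indepFun_train hmeas hindep n).comp hφm hψm
  have he2 : ∀ k, MemLp (fun ω => e ω k) 2 P := fun k =>
    (hCb k n (by omega)).1.comp_measurePreserving hDM
  have hu2 : ∀ l, MemLp (fun ω => u ω l) 2 P := fun l =>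
    (hCg l n hn).1.comp_measurePreserving hDN
  have hu0 : ∀ l, ∫ ω, u ω l ∂P = 0 := fun l =>
    (MeasurePreserving.hasMean hDN
      ⟨(hCg l n hn).1.integrable (by norm_num), (hCg l n hn).2.1⟩).2
  have huu : ∀ l, ∫ ω, u ω l ^ 2 ∂P ≤ Cg l / n := fun l => by
    rw [(MeasurePreserving.hasMean hDN (.of_integrable (hCg l n hn).1.integrable_sq)).2]
    exact (hCg l n hn).2.2
  have hee : ∫ ω, e ω j ^ 2 ∂P ≤ Cb j / n := by
    have h := hCb j n (by omega)
    rw [(MeasurePreserving.hasMean hDM (.of_integrable h.1.integrable_sq)).2]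
    exact h.2
  have huu' : ∀ l l', |∫ ω, u ω l * u ω l' ∂P| ≤ (Cg l + Cg l') / 2 / n := fun l l' => by
    have h1 : |∫ ω, u ω l * u ω l' ∂P| ≤ ∫ ω, (u ω l ^ 2 + u ω l' ^ 2) / 2 ∂P := by
      rw [← Real.norm_eq_abs]
      refine norm_integral_le_of_norm_le
        (((hu2 l).integrable_sq.add (hu2 l').integrable_sq).div_const 2)
        (Filter.Eventually.of_forall fun ω => ?_)
      rw [Real.norm_eq_abs, abs_le]
      constructor <;> nlinarith [sq_nonneg (u ω l + u ω l'), sq_nonneg (u ω l - u ω l')]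
    rw [integral_div, integral_add (hu2 l).integrable_sq (hu2 l').integrable_sq] at h1
    have h2 := huu l
    have h3 := huu l'
    have h4 : (Cg l + Cg l') / 2 / n = (Cg l / n + Cg l' / n) / 2 := by ring
    rw [h4]
    linarith
  set B : ℝ := (∫ ω, e ω j ^ 2 ∂P) * ∑ l, ∑ l', (∫ ω, u ω l * u ω l' ∂P) * M l l' with hB
  have hBC : |B| ≤ C / (n : ℝ) ^ 2 := by
    have h1 : |∑ l, ∑ l', (∫ ω, u ω l * u ω l' ∂P) * M l l'|
        ≤ (∑ l, ∑ l', (Cg l + Cg l') / 2 * |M l l'|) / n := by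
      simp_rw [Finset.sum_div]
      refine (Finset.abs_sum_le_sum_abs _ _).trans (Finset.sum_le_sum fun l _ => ?_)
      refine (Finset.abs_sum_le_sum_abs _ _).trans (Finset.sum_le_sum fun l' _ => ?_)
      rw [abs_mul, mul_div_right_comm]
      exact mul_le_mul_of_nonneg_right (huu' l l') (abs_nonneg _)
    have h2 : C / (n : ℝ) ^ 2 = Cb j / n * ((∑ l, ∑ l', (Cg l + Cg l') / 2 * |M l l'|) / n) := by
      rw [hC]
      field_simp
    rw [hB, abs_mul, abs_of_nonneg (integral_nonneg fun ω => sq_nonneg _), h2]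
    exact mul_le_mul hee h1 (abs_nonneg _) (div_nonneg (hCb0 j) hn0.le)
  have hterm : ∀ i : Fin nt, ∃ b, HasMean P (fun ω =>
      quadLoss (mHat (fun i : Fin n => data .trainM i ω) (condSample j
          (nuHat n fun i : Fin n => data .trainNu i ω) (data .test i ω).1
          (data .test (π i) ω).1)) (data .test i ω).2
        - quadLoss (mHat (fun i : Fin n => data .trainM i ω) (data .test i ω).1)
          (data .test i ω).2) b ∧ |b| ≤ C / (n : ℝ) ^ 2 := fun i => by
    have hpt := fun ω => loss_increment_eq hβ (fun i : Fin n => data .trainM i ω) (c := c) (γ := γ)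
      (hgν n fun i : Fin n => data .trainNu i ω) (data .test i ω).1 (data .test (π i) ω).1
      (data .test i ω).2
    -- At a fixed point of `π` the observation is unchanged and the increment is zero; elsewhere the
    -- two test observations are independent.
    by_cases hik : π i = i
    · have h0 : HasMean P (fun _ => (0 : ℝ)) 0 := ⟨integrable_zero _ _ _, by simp⟩
      exact ⟨0, h0.congr (fun ω => ((hpt ω).trans (by rw [hik]; simp)).symm) rfl, by
        simpa using div_nonneg hCnn (sq_nonneg _)⟩
    refine ⟨B, ?_, hBC⟩
    have hI : IndepFun (data .test i) (data .test (π i)) P :=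
      hindep.indepFun (i := (Fold.test, (i : ℕ))) (j := (Fold.test, (π i : ℕ))) fun h =>
        hik (Fin.ext (by simpa using (Prod.mk.inj h).2.symm))
    have hT : IndepFun (fun ω => (e ω, u ω)) (fun ω => (data .test i ω, data .test (π i) ω)) P :=
      (indepFun_train_test hmeas hindep n i (π i)).comp
        (φ := fun q : (Fin n → Obs p) × (Fin n → Obs p) =>
          ((fun k => betaHat q.1 k - β k), fun l => g n q.2 l - γ l)) (ψ := id)
        ((hφm.comp measurable_fst).prodMk (hψm.comp measurable_snd)) measurable_id
    have hmix := fun (a b : Obs p → ℝ) (ha : Measurable a) (hb : Measurable b)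
      (ha2 : MemLp a 2 P₀) (hb2 : MemLp b 2 P₀) =>
      hasMean_sub_mul (hT1 i) (hT1 (π i)) hI ha hb ha2 hb2
    have hρm' : Measurable fun z : Obs p => ρ z.1 := by fun_prop
    have hxm : ∀ k, Measurable fun z : Obs p => z.1 k := fun k => by fun_prop
    have hdxm : ∀ l, Measurable fun z : Obs p => drop j z.1 l := fun l => hxm l
    have hdx2 : ∀ l, MemLp (fun z : Obs p => drop j z.1 l) 2 P₀ := fun l => hx2 l
    have key := hasMean_loss_increment j hT heu he2 hu2 hu0
      (dρ := fun t => ρ t.2.1 - ρ t.1.1) (ε := fun t => ε t.1)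
      (dx := fun l t => drop j t.2.1 l - drop j t.1.1 l) (x := fun k t => t.1.1 k)
      (by fun_prop) (by fun_prop)
      (fun l => ((hdxm l).comp measurable_snd).sub ((hdxm l).comp measurable_fst))
      (fun k => (hxm k).comp measurable_fst) v M
      ((hmix _ _ hρm' hρm' hρ2 hρ2).2.congr (fun _ => rfl) (by rw [hρρ, hρ0]; ring))
      (fun k => (hmix _ _ hρm' (hxm k) hρ2 (hx2 k)).1.congr (fun _ => rfl) (by
        rw [hρx, hρ0]
        split_ifs <;> ring))
      ((hmix _ _ hρm' hεm hρ2 hε2).1.congr (fun _ => rfl) (by rw [hρε, hρ0]; ring))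
      (fun l => (hmix _ _ hρm' (hdxm l) hρ2 (hdx2 l)).2.1)
      (fun l l' => (hmix _ _ (hdxm l) (hdxm l') (hdx2 l) (hdx2 l')).2)
      (fun l k => (hmix _ _ (hdxm l) (hxm k) (hdx2 l) (hx2 k)).1.1)
      (fun l => (hmix _ _ (hdxm l) hεm (hdx2 l) hε2).1.1)
    exact key.congr (fun ω => (hpt ω).symm) rfl
  choose b hb hbC using hterm
  refine ⟨measurable_cpi j (hg₀m n) (hgm n) (hgν n) π, 1 / (nt : ℝ) * ∑ i, b i, (HasMean.sum hb).const_mul _, ?_⟩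
  have hnt0 : (0 : ℝ) < nt := by exact_mod_cast hnt
  rw [abs_mul, abs_of_pos (by positivity), one_div, inv_mul_le_iff₀ hnt0]
  refine (Finset.abs_sum_le_sum_abs _ _).trans ((Finset.sum_le_sum fun i _ => hbC i).trans_eq ?_)
  simp

/-! ### Random permutations -/

/-- A random choice among finitely many estimates, independent of them, keeps a common bound on
their means. -/
theorem hasMean_of_random_index {Ω ι 𝓓 : Type*} [MeasurableSpace Ω] [Fintype ι] [DecidableEq ι]
    [MeasurableSpace 𝓓] {P : Measure Ω} [IsProbabilityMeasure P] {π : Ω → ι} {X : Ω → 𝓓}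
    (hπ : ∀ a, MeasurableSet (π ⁻¹' {a}))
    (hI : ∀ a, IndepFun ((π ⁻¹' {a}).indicator fun _ => (1 : ℝ)) X P)
    {F : ι → 𝓓 → ℝ} (hF : ∀ a, Measurable (F a)) {b : ι → ℝ} {B : ℝ}
    (hb : ∀ a, HasMean P (fun ω => F a (X ω)) (b a)) (hbB : ∀ a, |b a| ≤ B) :
    Integrable (fun ω => F (π ω) (X ω)) P ∧ |∫ ω, F (π ω) (X ω) ∂P| ≤ B := by
  have h1 : ∀ a, HasMean P ((π ⁻¹' {a}).indicator fun _ => (1 : ℝ)) (P.real (π ⁻¹' {a})) :=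
    fun a => ⟨(integrable_const 1).indicator (hπ a), by
      rw [integral_indicator (hπ a)]
      simp⟩
  -- Splitting along the value of `π`, independence makes the mean the convex combination `∑ P(π =
  -- a) b a`.
  have h2 := HasMean.sum fun a => (h1 a).mul_of_indepFun (hb a)
    ((hI a).comp measurable_id (hF a))
  have h3 : ∀ ω, ∑ a, (π ⁻¹' {a}).indicator (fun _ => (1 : ℝ)) ω * F a (X ω) = F (π ω) (X ω) :=
    fun ω => by
      rw [Finset.sum_eq_single (π ω) (fun a _ ha => ?_) (by simp)]
      · simp
      · simp [Set.indicator, ha.symm]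
  have h4 := h2.congr h3 rfl
  have h5 := HasMean.sum h1
  have h6 : ∑ a, P.real (π ⁻¹' {a}) = 1 := by
    rw [← h5.2]
    have : ∀ ω, ∑ a, (π ⁻¹' {a}).indicator (fun _ => (1 : ℝ)) ω = 1 := fun ω => by
      simp [Set.indicator]
    simp [this]
  refine ⟨h4.1, ?_⟩
  rw [h4.2]
  refine (Finset.abs_sum_le_sum_abs _ _).trans ?_
  calc ∑ a, |P.real (π ⁻¹' {a}) * b a| ≤ ∑ a, P.real (π ⁻¹' {a}) * B := by
        refine Finset.sum_le_sum fun a _ => ?_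
        rw [abs_mul, abs_of_nonneg measureReal_nonneg]
        exact mul_le_mul_of_nonneg_left (hbB a) measureReal_nonneg
    _ = B := by rw [← Finset.sum_mul, h6, one_mul]

end CPI

theorem lemma2 {p : ℕ} (j : Fin p)
    -- the law of `(X, y)`: Gaussian covariates, linear model, conditional null hypothesis
    (P₀ : Measure (CPI.Obs p)) [IsProbabilityMeasure P₀]
    (μ : EuclideanSpace ℝ (Fin p)) (S : Matrix (Fin p) (Fin p) ℝ) (hS : S.PosDef)
    (hX : P₀.map Prod.fst = multivariateGaussian μ S)
    (β : Fin p → ℝ) (σ : ℝ≥0) (hLM : CPI.LinearModel P₀ β σ)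
    (hnull : CPI.ConditionalNull P₀ j)
    -- the data: three samples of i.i.d. observations with law `P₀`, independent of each other
    {Ω : Type*} [MeasurableSpace Ω] (P : Measure Ω) [IsProbabilityMeasure P]
    (data : CPI.Fold → ℕ → Ω → CPI.Obs p)
    (hmeas : ∀ s i, Measurable (data s i))
    (hlaw : ∀ s i, P.map (data s i) = P₀)
    (hindep : iIndepFun (fun k : CPI.Fold × ℕ => data k.1 k.2) P)
    -- the least squares regressor of `X^j` on `X^{-j}`: with an intercept, which may be left out
    -- if the covariates are centered
    (nuHat : (n : ℕ) → (Fin n → CPI.Obs p) → ({l : Fin p // l ≠ j} → ℝ) → ℝ)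
    (hnu : nuHat = CPI.nuHatAffine j ∨ (μ = 0 ∧ nuHat = CPI.nuHatLinear j)) :
    ∃ (C : ℝ) (N : ℕ), ∀ ntrain : ℕ, N ≤ ntrain → ∀ ntest : ℕ, 0 < ntest →
      -- a permutation of the test individuals, possibly random, independent of the data
      ∀ π : Ω → Equiv.Perm (Fin ntest), Measurable (fun ω => ⇑(π ω)) →
        IndepFun (fun ω => ⇑(π ω)) (fun ω s i => data s i ω) P →
        Integrable (fun ω => CPI.cpi CPI.quadLoss j
            (CPI.mHat fun i : Fin ntrain => data .trainM i ω)
            (nuHat ntrain fun i : Fin ntrain => data .trainNu i ω)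
            (π ω) (fun i : Fin ntest => data .test i ω)) P ∧
        |∫ ω, CPI.cpi CPI.quadLoss j
            (CPI.mHat fun i : Fin ntrain => data .trainM i ω)
            (nuHat ntrain fun i : Fin ntrain => data .trainNu i ω)
            (π ω) (fun i : Fin ntest => data .test i ω) ∂P| ≤ C / (ntrain : ℝ) ^ 2 := by
  classical
  obtain ⟨C, N, h⟩ := CPI.exists_hasMean_cpi_le j hS hX hLM hnull hmeas hlaw hindep nuHat hnu
  refine ⟨C, N, fun n hn nt hnt π hπ hπI => ?_⟩
  choose hF b hb hbC using h n hn nt hnt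
  -- A permutation is determined by its underlying function, through which measurability and
  -- independence of `π` are expressed.
  have hpre : ∀ a : Equiv.Perm (Fin nt), π ⁻¹' {a} = (fun ω => ⇑(π ω)) ⁻¹' {⇑a} := fun a => by
    ext ω
    simp
  refine CPI.hasMean_of_random_index (X := fun ω s i => data s i ω) (π := π)
    (F := fun a q => CPI.cpi CPI.quadLoss j (CPI.mHat fun i : Fin n => q .trainM i)
      (nuHat n fun i : Fin n => q .trainNu i) a (fun i : Fin nt => q .test i))
    (fun a => ?_) (fun a => ?_) hF hb hbC
  · rw [hpre]
    exact hπ (measurableSet_singleton _)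
  · rw [hpre]
    exact hπI.comp (φ := ({⇑a} : Set (Fin nt → Fin nt)).indicator fun _ => (1 : ℝ)) (ψ := id)
      (measurable_const.indicator (measurableSet_singleton _)) measurable_id
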